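/- Let $G=(V,E)$ be a finite directed graph (parallel edges allowed) with $m=|E|\ge 2$ edges. Finitely many agents $j$ each own a set $S_j\subseteq E$, with a norm index $p_j\in[1,\infty]$ and a capacity $c_j$. Requests $(s_i,t_i)\in V\times V$ arrive one at a time. On the arrival of a request an online algorithm, which knows $G$ and all $(S_j,p_j,c_j)$ but not the future requests, irrevocably either rejects the request or serves it by choosing a simple directed $s_i$–$t_i$ path and allocating bandwidth $1$ along it. The load $\mu_e$ of an edge is the number of served requests whose path contains $e$, and a routing is feasible if $\|\mu(S_j)\|_{p_j}\le c_j$ for every $j$, where $\|\mu(S)\|_p$ is the $\ell_p$-norm of the vector $(\mu_e)_{e\in S}$. The goal is to maximize the throughput, that is, the number of served requests. **Theorem.** There are absolute constants $A,C>0$ such that the following holds. Suppose that every edge lies in at most $L$ of the sets $S_j$ ($L\ge 1$), and that $c_j\ge A\log m\cdot|S_j|^{1/p_j}$ for every $j$ (with $1/\infty=0$). Then there is a randomized online algorithm that always produces a feasible routing and that is $C\log(Lm)$-competitive against oblivious adversaries: for every finite sequence of requests, $$\mathrm{OPT}\;\le\; C\log(Lm)\cdot\mathbb{E}[\mathrm{ALG}],$$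 where $\mathrm{ALG}$ is the throughput of the algorithm and $\mathrm{OPT}$ is the maximum throughput of a feasible routing when the whole sequence is known in advance. In particular, if the sets $S_j$ are pairwise disjoint ($L=1$), the algorithm is $O(\log m)$-competitive. -/

import Mathlib

open MeasureTheory
open scoped ENNReal

/-- A directed multigraph on the vertices `V` with edges `E`, together with agents `J`: agent `j`
owns the set `S j` of edges and requires that the `ℓ_{p j}`-norm of the loads on `S j` be at
most `c j`, where `1 ≤ p j ≤ ∞`. -/
structure RoutingNetwork (V E J : Type*) where
  src : E → V
  tgt : E → V
  S : J → Finset E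
  p : J → ℝ≥0∞
  one_le_p : ∀ j, 1 ≤ p j
  c : J → ℝ

/-- A randomized online algorithm for routing requests in `V × V` along lists of edges in `E`.
`decide ω past r` is the irrevocable decision on the newly arrived request `r` when the requests
`past` (in order of arrival) have come before it and the outcome of the random coins is `ω`:
either reject (`none`), or route along a path (`some P`). The earlier decisions of the algorithm
are functions of `ω` and `past`. -/
structure RandomizedOnlineAlgorithm (V E : Type*) where
  Ω : Type
  mΩ : MeasurableSpace Ω
  prob : Measure Ω
  isProb : IsProbabilityMeasure prob
  decide : Ω → List (V × V) → V × V → Option (List E)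
  measurableSet_decide : ∀ past r a, MeasurableSet {ω | decide ω past r = a}

namespace RandomizedOnlineAlgorithm

attribute [instance] RandomizedOnlineAlgorithm.mΩ RandomizedOnlineAlgorithm.isProb

/-- The routing that the algorithm produces on the sequence `reqs` of requests when the coins come
up `ω`: the `i`-th decision sees only the requests up to and including the `i`-th. -/
def route {V E : Type*} (alg : RandomizedOnlineAlgorithm V E) (reqs : List (V × V)) (ω : alg.Ω) :
    Fin reqs.length → Option (List E) :=
  fun i => alg.decide ω (reqs.take i) (reqs.get i)

end RandomizedOnlineAlgorithm

namespace RoutingNetwork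

/-- The list of edges is a directed walk from the first vertex to the second one. -/
def IsWalk {V E J : Type*} (N : RoutingNetwork V E J) : V → V → List E → Prop
  | s, t, [] => s = t
  | s, t, e :: P => N.src e = s ∧ N.IsWalk (N.tgt e) t P

/-- A directed walk from `s` to `t` that visits no vertex twice. -/
def IsSimplePath {V E J : Type*} (N : RoutingNetwork V E J) (s t : V) (P : List E) : Prop :=
  N.IsWalk s t P ∧ (s :: P.map N.tgt).Nodup

/-- The load on the edge `e`: the number of served requests whose path uses `e`
(each served request gets bandwidth one on its path). -/
noncomputable def load {E : Type*} {n : ℕ} (R : Fin n → Option (List E)) (e : E) : ℕ :=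
  Set.ncard {i | ∃ P, R i = some P ∧ e ∈ P}

/-- The number of served requests. -/
noncomputable def throughput {E : Type*} {n : ℕ} (R : Fin n → Option (List E)) : ℕ :=
  Set.ncard {i | ∃ P, R i = some P}

/-- Every served request is routed along a simple path from its source to its destination, and the
loads satisfy all the norm capacity constraints. -/
def IsFeasible {V E J : Type*} (N : RoutingNetwork V E J) (reqs : List (V × V))
    (R : Fin reqs.length → Option (List E)) : Prop :=
  (∀ i P, R i = some P → N.IsSimplePath (reqs.get i).1 (reqs.get i).2 P) ∧
    ∀ j, ‖WithLp.toLp (N.p j) (fun e : N.S j => (load R (e : E) : ℝ))‖ ≤ N.c j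

/-- On every (oblivious) sequence of requests, the algorithm always produces a feasible routing, and
the throughput of every feasible offline routing is at most `ratio` times its expected
throughput. -/
def IsCompetitive {V E J : Type*} (N : RoutingNetwork V E J)
    (alg : RandomizedOnlineAlgorithm V E) (ratio : ℝ) : Prop :=
  ∀ reqs : List (V × V),
    (∀ ω, N.IsFeasible reqs (alg.route reqs ω)) ∧
    ∀ R : Fin reqs.length → Option (List E), N.IsFeasible reqs R →
      (throughput R : ℝ) ≤
        ratio * ∫ ω, (throughput (alg.route reqs ω) : ℝ) ∂alg.prob

end RoutingNetwork

/-!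
The algorithm is deterministic, which is a special case of a randomized one (the probability space
is a point). It combines two online procedures; write `m` for the number of edges, and let `q` be
a constant times `log (L m)`.

*Virtual routing.* Every virtually served request gets bandwidth `1 / q`. An agent with set `S` and
norm exponent `r` contributes a multiple of `‖y(S)‖_r ^ q` to a potential, where `y e` is the
virtual load of `e`, counted in requests and shifted by `q`. The price of an edge is the
partial derivative of the potential, and a request is virtually served along any simple path of
price at most `1`. As `q ≥ r`, prices never decrease over time, so an offline request that was
rejected pays at least `1` at the final prices; on the other hand a feasible offline routing costs
at most a constant times the sum of the final potential and the number of virtually served requests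
(`sum_agentPrice_mul_le`), and each virtually served request raised the potential by a constant only
(`agentPotential_add_le`; the shift by `q` makes the unit steps harmless). Hence OPT is at most a
constant times the number of virtually served requests
(`AgentFamily.prefixServed_le_of_cheap`). The norms of the virtual loads stay bounded: once the
`r`-th power mean of the loads of an agent exceeds a fixed fraction of the capacity per edge, only
its edges with load below this fraction remain cheap (`heavySum_add_le`).

*Thinning.* About one in `q` virtually served requests is actually served, in such a way that the
load of each edge is at most twice its virtual load divided by `q`, plus `log m + 1`. Sampling would
do this with high probability. The pessimistic estimator
`∑ e, exp (load e - (2 / q) * virtual load e) / m` does it deterministically: a request is kept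
if its path contributes at most `1` to the sum. A kept request raises the sum by at most `2`, and
a discarded one lowers it by at least `1 / q` (`IsThinning.sum_overload_le`), so that a fraction of
at least `1 / (4 q)` is kept (`IsThinning.prefixServed_le`). The additive `log m + 1` fits into the
capacities, which are at least a large multiple of `log m` per edge
(`AgentFamily.sum_actual_load_rpow_le`).

Only the agents with nonempty sets matter, and there are at most `L m` of them. Exponents `p_j` above
`2 log m` are replaced by `2 log m`, which changes the norms by a constant factor
(`norm_le_of_sum_div_edgeCapacity_rpow_le`).
-/

/-! ### Elementary inequalities for real powers -/

theorem Real.rpow_sub_rpow_le {x y ρ : ℝ} (hy : 0 < y) (hxy : y ≤ x) (hρ : 1 ≤ ρ) :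
    x ^ ρ - y ^ ρ ≤ ρ * x ^ (ρ - 1) * (x - y) := by
  have hx : 0 < x := hy.trans_le hxy
  have hb := one_add_mul_self_le_rpow_one_add (s := y / x - 1) (by
    have : 0 < y / x := by positivity
    linarith) hρ
  have h1 : (1 + (y / x - 1)) ^ ρ = y ^ ρ / x ^ ρ := by
    rw [add_sub_cancel, Real.div_rpow hy.le hx.le]
  rw [h1, le_div_iff₀ (by positivity)] at hb
  have h2 : x ^ ρ = x ^ (ρ - 1) * x := by
    rw [← Real.rpow_add_one hx.ne']; congr 1; ring
  have h3 : (1 + ρ * (y / x - 1)) * x ^ ρ = x ^ ρ - ρ * x ^ (ρ - 1) * (x - y) := by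
    rw [h2]; field_simp; ring
  linarith

/-- A form of Young's inequality that favours `u` over `w` by a factor exponentially small
in the exponent. -/
theorem Real.rpow_sub_one_mul_le {w u r : ℝ} (hw : 0 < w) (hu : 0 ≤ u) (hr : 1 ≤ r) :
    w ^ (r - 1) * u ≤ Real.exp 1 * w ^ r + Real.exp (1 - r) * u ^ r := by
  have he : 0 < Real.exp 1 := Real.exp_pos 1
  rcases le_total u (Real.exp 1 * w) with h | h
  · have h2 : w ^ r = w ^ (r - 1) * w := by
      rw [← Real.rpow_add_one hw.ne']; congr 1; ring
    have : w ^ (r - 1) * u ≤ w ^ (r - 1) * (Real.exp 1 * w) := by gcongr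
    have h3 : 0 ≤ Real.exp (1 - r) * u ^ r := by positivity
    rw [h2]; linarith
  · have hu' : 0 < u := lt_of_lt_of_le (by positivity) h
    have h2 : u ^ r = u ^ (r - 1) * u := by
      rw [← Real.rpow_add_one hu'.ne']; congr 1; ring
    have hwu : w ≤ u * Real.exp (-1) := by
      rw [Real.exp_neg, ← div_eq_mul_inv, le_div_iff₀ he]; linarith
    have h4 : w ^ (r - 1) ≤ u ^ (r - 1) * Real.exp (1 - r) := by
      calc w ^ (r - 1) ≤ (u * Real.exp (-1)) ^ (r - 1) :=
            Real.rpow_le_rpow hw.le hwu (by linarith)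
        _ = _ := by
            rw [Real.mul_rpow hu (Real.exp_pos _).le, ← Real.exp_mul]; congr 2; ring
    have h5 : w ^ (r - 1) * u ≤ u ^ (r - 1) * Real.exp (1 - r) * u := by gcongr
    have h6 : 0 ≤ Real.exp 1 * w ^ r := by positivity
    rw [h2]; linarith

theorem Real.one_add_inv_rpow_le {q t : ℝ} (hq : 0 < q) (ht : t ≤ q) :
    (1 + 1 / q) ^ t ≤ Real.exp 1 := by
  have h1 : (1 : ℝ) ≤ 1 + 1 / q := by
    have : 0 < 1 / q := by positivity
    linarith
  calc (1 + 1 / q) ^ t ≤ (1 + 1 / q) ^ q := Real.rpow_le_rpow_of_exponent_le h1 ht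
    _ ≤ (Real.exp (1 / q)) ^ q := by
        apply Real.rpow_le_rpow (by linarith) _ hq.le
        have := Real.add_one_le_exp (1 / q); linarith
    _ = Real.exp 1 := by rw [← Real.exp_mul]; congr 1; field_simp

/-! ### Prices and the potential of one agent -/

section Agent

variable {E : Type*}

/-- The mean over `S` of the `r`-th powers of the relative loads `y e / d`. -/
noncomputable def relMean (S : Finset E) (r d : ℝ) (y : E → ℝ) : ℝ :=
  (∑ e ∈ S, (y e / d) ^ r) / S.card

/-- The price that an agent owning `S` charges for one more unit of load on `e`. It is the partial
derivative of `agentPotential` with respect to `y e`. -/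
noncomputable def agentPrice (S : Finset E) (r q d : ℝ) (y : E → ℝ) (e : E) : ℝ :=
  relMean S r d y ^ (q / r - 1) * (y e / d) ^ (r - 1)

/-- The potential of an agent owning `S`: up to normalisation, the `q`-th power of the `ℓ_r`-norm
of the loads on `S`. -/
noncomputable def agentPotential (S : Finset E) (r q d : ℝ) (y : E → ℝ) : ℝ :=
  d * S.card / q * relMean S r d y ^ (q / r)

variable {S : Finset E} {r q d : ℝ} {y y' : E → ℝ}

theorem relMean_pos (hS : S.Nonempty) (hd : 0 < d) (hy : ∀ e, 0 < y e) :
    0 < relMean S r d y := by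
  unfold relMean
  have hk : (0 : ℝ) < S.card := by exact_mod_cast hS.card_pos
  refine div_pos (Finset.sum_pos (fun e _ => ?_) hS) hk
  have := hy e
  positivity

theorem relMean_mono (hr : 1 ≤ r) (hd : 0 < d) (hy : ∀ e, 0 < y e) (h : ∀ e, y e ≤ y' e) :
    relMean S r d y ≤ relMean S r d y' := by
  unfold relMean
  gcongr with e he
  · have := hy e
    positivity
  · exact h e

theorem relMean_le_of_le {ω : ℝ} (hS : S.Nonempty) (hr : 1 ≤ r) (hd : 0 < d)
    (hy : ∀ e, 0 < y e) (h : ∀ e, y e / d ≤ ω) : relMean S r d y ≤ ω ^ r := by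
  have hk : (0 : ℝ) < S.card := by exact_mod_cast hS.card_pos
  rw [relMean, div_le_iff₀ hk]
  calc ∑ e ∈ S, (y e / d) ^ r ≤ ∑ e ∈ S, ω ^ r := by
        refine Finset.sum_le_sum fun e _ => ?_
        have := hy e
        exact Real.rpow_le_rpow (by positivity) (h e) (by linarith)
    _ = ω ^ r * S.card := by simp [mul_comm]

theorem relMean_mul_card (hS : S.Nonempty) :
    relMean S r d y * S.card = ∑ e ∈ S, (y e / d) ^ r := by
  have hk : (S.card : ℝ) ≠ 0 := by exact_mod_cast hS.card_pos.ne'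
  rw [relMean, div_mul_cancel₀ _ hk]

theorem relMean_le_mul {γ : ℝ} (hγ : 0 ≤ γ) (hr : 1 ≤ r) (hd : 0 < d) (hy : ∀ e, 0 < y e)
    (hy' : ∀ e, 0 < y' e) (h : ∀ e, y' e ≤ γ * y e) :
    relMean S r d y' ≤ γ ^ r * relMean S r d y := by
  unfold relMean
  rw [← mul_div_assoc, Finset.mul_sum]
  gcongr with e he
  have h1 := hy e
  have h2 := hy' e
  rw [← Real.mul_rpow hγ (by positivity)]
  refine Real.rpow_le_rpow (by positivity) ?_ (by linarith)
  rw [← mul_div_assoc]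
  gcongr
  exact h e

theorem agentPrice_nonneg (hS : S.Nonempty) (hd : 0 < d) (hy : ∀ e, 0 < y e) (e : E) :
    0 ≤ agentPrice S r q d y e := by
  have h1 := relMean_pos (r := r) hS hd hy
  have h2 := hy e
  unfold agentPrice
  positivity

theorem agentPrice_mono (hS : S.Nonempty) (hr : 1 ≤ r) (hrq : r ≤ q) (hd : 0 < d)
    (hy : ∀ e, 0 < y e) (h : ∀ e, y e ≤ y' e) (e : E) :
    agentPrice S r q d y e ≤ agentPrice S r q d y' e := by
  have h1 := relMean_pos (r := r) hS hd hy
  have h1' := relMean_mono (S := S) hr hd hy h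
  have h2 := hy e
  have h3 : 0 ≤ q / r - 1 := by
    rw [sub_nonneg, one_le_div (by linarith)]; exact hrq
  have h4 : 0 ≤ r - 1 := by linarith
  have h5 := h e
  have h6 := h1.trans_le h1'
  unfold agentPrice
  gcongr

/-- Additional loads `x e ≤ 1` raise the potential by at most a constant times the price of
`x`: by convexity the increase is at most the price of `x` at the new loads, and
since all `y e ≥ q`, the new prices exceed the old ones by at most `(1 + 1 / q) ^ (q - 1)`. -/
theorem agentPotential_add_le (hS : S.Nonempty) (hr : 1 ≤ r) (hrq : r ≤ q) (hd : 0 < d)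
    (hy : ∀ e, q ≤ y e) (x : E → ℝ) (hx0 : ∀ e, 0 ≤ x e) (hx1 : ∀ e, x e ≤ 1) :
    agentPotential S r q d (fun e => y e + x e) ≤
      agentPotential S r q d y + Real.exp 1 * ∑ e ∈ S, agentPrice S r q d y e * x e := by
  have hq : 0 < q := by linarith
  have hr0 : 0 < r := by linarith
  have hk : (0 : ℝ) < S.card := by exact_mod_cast hS.card_pos
  have hy0 : ∀ e, 0 < y e := fun e => hq.trans_le (hy e)
  set y' : E → ℝ := fun e => y e + x e with hy'
  have hy'0 : ∀ e, 0 < y' e := fun e => by have := hy0 e; have := hx0 e; simp only [hy']; linarith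
  set γ : ℝ := 1 + 1 / q with hγ
  have hγ0 : 0 < γ := by positivity
  have hyγ : ∀ e, y' e ≤ γ * y e := fun e => by
    have h1 : 1 ≤ 1 / q * y e := by
      rw [one_div, inv_mul_eq_div, one_le_div hq]; exact hy e
    have := hx1 e
    simp only [hy', hγ]; linarith
  have hyy' : ∀ e, y e ≤ y' e := fun e => by have := hx0 e; simp only [hy']; linarith
  set T := relMean S r d y with hT
  set T' := relMean S r d y' with hT'
  have hT0 : 0 < T := relMean_pos hS hd hy0
  have hT'0 : 0 < T' := relMean_pos hS hd hy'0
  have hTT' : T ≤ T' := relMean_mono hr hd hy0 hyy'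
  have hT'T : T' ≤ γ ^ r * T := relMean_le_mul hγ0.le hr hd hy0 hy'0 hyγ
  have hρ : 1 ≤ q / r := by rw [one_le_div hr0]; exact hrq
  have hdiff : T' - T ≤ r * γ ^ (r - 1) / (S.card * d) * ∑ e ∈ S, (y e / d) ^ (r - 1) * x e := by
    have hsum : T' - T = (∑ e ∈ S, ((y' e / d) ^ r - (y e / d) ^ r)) / S.card := by
      rw [hT, hT', relMean, relMean, Finset.sum_sub_distrib, sub_div]
    rw [hsum, div_le_iff₀ hk, Finset.mul_sum, Finset.sum_mul]
    refine Finset.sum_le_sum fun e _ => ?_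
    have h1 := hy0 e
    have h2 := hy'0 e
    have h3 := hx0 e
    calc (y' e / d) ^ r - (y e / d) ^ r
        ≤ r * (y' e / d) ^ (r - 1) * (y' e / d - y e / d) :=
          Real.rpow_sub_rpow_le (by positivity) (by gcongr; exact hyy' e) hr
      _ ≤ r * (γ * (y e / d)) ^ (r - 1) * (y' e / d - y e / d) := by
          have h4 : 0 ≤ y' e / d - y e / d := by
            rw [← sub_div]; have : y' e - y e = x e := by simp [hy']
            rw [this]; positivity
          have h5 : (y' e / d) ^ (r - 1) ≤ (γ * (y e / d)) ^ (r - 1) := by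
            refine Real.rpow_le_rpow (by positivity) ?_ (by linarith)
            rw [← mul_div_assoc]; gcongr; exact hyγ e
          gcongr
      _ = _ := by
          rw [Real.mul_rpow hγ0.le (by positivity)]
          have : y' e / d - y e / d = x e / d := by simp [hy', add_div]
          rw [this]; field_simp
  set X := ∑ e ∈ S, (y e / d) ^ (r - 1) * x e with hX
  have hX0 : 0 ≤ X := Finset.sum_nonneg fun e _ => by
    have := hy0 e; have := hx0 e; positivity
  have hρ0 : 0 ≤ q / r - 1 := by linarith
  have hpow : T' ^ (q / r) - T ^ (q / r) ≤
      q / r * (γ ^ r * T) ^ (q / r - 1) * (r * γ ^ (r - 1) / (S.card * d) * X) := by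
    calc T' ^ (q / r) - T ^ (q / r) ≤ q / r * T' ^ (q / r - 1) * (T' - T) :=
          Real.rpow_sub_rpow_le hT0 hTT' hρ
      _ ≤ q / r * (γ ^ r * T) ^ (q / r - 1) * (T' - T) := by
          have : 0 ≤ T' - T := by linarith
          gcongr
      _ ≤ _ := by gcongr
  have hγpow : (γ ^ r) ^ (q / r - 1) * γ ^ (r - 1) ≤ Real.exp 1 := by
    rw [← Real.rpow_mul hγ0.le, ← Real.rpow_add hγ0]
    refine Real.one_add_inv_rpow_le hq ?_
    have : r * (q / r - 1) + (r - 1) = q - 1 := by field_simp; ring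
    linarith
  have hprice : ∑ e ∈ S, agentPrice S r q d y e * x e = T ^ (q / r - 1) * X := by
    rw [hX, Finset.mul_sum]
    refine Finset.sum_congr rfl fun e _ => ?_
    rw [agentPrice, ← hT]; ring
  rw [hprice]
  have hfin : agentPotential S r q d y' - agentPotential S r q d y ≤
      Real.exp 1 * (T ^ (q / r - 1) * X) := by
    calc agentPotential S r q d y' - agentPotential S r q d y
        = d * S.card / q * (T' ^ (q / r) - T ^ (q / r)) := by
          rw [agentPotential, agentPotential, ← hT, ← hT']; ring
      _ ≤ d * S.card / q *
          (q / r * (γ ^ r * T) ^ (q / r - 1) * (r * γ ^ (r - 1) / (S.card * d) * X)) := by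
          gcongr
      _ = ((γ ^ r) ^ (q / r - 1) * γ ^ (r - 1)) * (T ^ (q / r - 1) * X) := by
          rw [Real.mul_rpow (by positivity) hT0.le]; field_simp
      _ ≤ _ := by gcongr
  linarith

/-- The agent's prices charge a load vector `μ` that respects the agent's capacity (`b * d / q` per
edge, in the sense of `r`-th power means) essentially at most the agent's potential. When the
`r`-th power mean of the relative loads is below `exp (-1)`, the prices are so small that a
bound by the largest load `Y` suffices. -/
theorem sum_agentPrice_mul_le (hS : S.Nonempty) (hr : 1 ≤ r) (hrq : r + 1 ≤ q) (hd : 0 < d)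
    (hy : ∀ e, 0 < y e) {b Y : ℝ} (hb : 0 < b) (hY : ∀ e, y e ≤ Y) (μ : E → ℝ)
    (hμ0 : ∀ e, 0 ≤ μ e) (hμ : ∑ e ∈ S, (μ e / (b * d / q)) ^ r ≤ S.card) :
    ∑ e ∈ S, agentPrice S r q d y e * μ e ≤
      2 * Real.exp 1 * b * agentPotential S r q d y
        + b * (Y / q) * S.card * Real.exp (2 - q) := by
  have hq : 0 < q := by linarith
  have hr0 : 0 < r := by linarith
  have hk : (0 : ℝ) < S.card := by exact_mod_cast hS.card_pos
  set T := relMean S r d y with hT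
  have hT0 : 0 < T := relMean_pos hS hd hy
  set g := b * d / q with hg
  have hg0 : 0 < g := by positivity
  have hY0 : 0 < Y := by
    obtain ⟨e, _⟩ := hS
    exact (hy e).trans_le (hY e)
  have hexp : T ^ (q / r) = T ^ (q / r - 1) * T := by
    rw [← Real.rpow_add_one hT0.ne']; congr 1; ring
  have hpot : b * agentPotential S r q d y = g * S.card * (T ^ (q / r - 1) * T) := by
    rw [agentPotential, ← hT, hexp, hg]; ring
  have hT1 : 0 < T ^ (q / r - 1) := by positivity
  have hmain : ∑ e ∈ S, agentPrice S r q d y e * μ e ≤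
      T ^ (q / r - 1) * g * (S.card * (Real.exp 1 * T + Real.exp (1 - r))) := by
    calc ∑ e ∈ S, agentPrice S r q d y e * μ e
        = T ^ (q / r - 1) * g * ∑ e ∈ S, (y e / d) ^ (r - 1) * (μ e / g) := by
          rw [Finset.mul_sum]
          refine Finset.sum_congr rfl fun e _ => ?_
          rw [agentPrice, ← hT]; field_simp
      _ ≤ T ^ (q / r - 1) * g *
          ∑ e ∈ S, (Real.exp 1 * (y e / d) ^ r + Real.exp (1 - r) * (μ e / g) ^ r) := by
          gcongr with e he
          have h1 := hy e
          have h2 := hμ0 e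
          exact Real.rpow_sub_one_mul_le (by positivity) (by positivity) hr
      _ = T ^ (q / r - 1) * g *
          (Real.exp 1 * (T * S.card) + Real.exp (1 - r) * ∑ e ∈ S, (μ e / g) ^ r) := by
          rw [Finset.sum_add_distrib, ← Finset.mul_sum, ← Finset.mul_sum, hT,
            relMean_mul_card hS]
      _ ≤ T ^ (q / r - 1) * g *
          (Real.exp 1 * (T * S.card) + Real.exp (1 - r) * S.card) := by gcongr
      _ = _ := by ring
  have he1 : Real.exp (1 - r) = Real.exp 1 * Real.exp (-r) := by
    rw [← Real.exp_add]; congr 1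
  rcases le_total (Real.exp (-r)) T with h | h
  · have h0 : 0 ≤ b * (Y / q) * S.card * Real.exp (2 - q) := by positivity
    have h1 : T ^ (q / r - 1) * g * (S.card * (Real.exp 1 * T + Real.exp (1 - r))) ≤
        T ^ (q / r - 1) * g * (S.card * (Real.exp 1 * T + Real.exp 1 * T)) := by
      rw [he1]; gcongr
    have h2 : 2 * Real.exp 1 * b * agentPotential S r q d y =
        T ^ (q / r - 1) * g * (S.card * (Real.exp 1 * T + Real.exp 1 * T)) := by
      rw [mul_assoc (2 * Real.exp 1), hpot]; ring
    linarith
  -- the root `X` of the mean is at most `Y / d` and at most `exp (-1)`; the first bound is used for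
  -- one factor of `X ^ (q - r)`, the second one for the others
  · set X := T ^ (1 / r) with hX
    have hX0 : 0 < X := by positivity
    have hXY : X ≤ Y / d := by
      have h1 : T ≤ (Y / d) ^ r :=
        relMean_le_of_le hS hr hd hy fun e => by gcongr; exact hY e
      calc X ≤ ((Y / d) ^ r) ^ (1 / r) := Real.rpow_le_rpow hT0.le h1 (by positivity)
        _ = Y / d := by
          rw [← Real.rpow_mul (by positivity), mul_one_div_cancel hr0.ne', Real.rpow_one]
    have hXe : X ≤ Real.exp (-1) := by
      calc X ≤ (Real.exp (-r)) ^ (1 / r) := Real.rpow_le_rpow hT0.le h (by positivity)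
        _ = Real.exp (-1) := by rw [← Real.exp_mul]; congr 1; field_simp
    have hTX : T ^ (q / r - 1) ≤ Y / d * Real.exp (-(q - r - 1)) := by
      have h1 : T ^ (q / r - 1) = X * X ^ (q - r - 1) := by
        rw [mul_comm, ← Real.rpow_add_one hX0.ne', hX, ← Real.rpow_mul hT0.le]
        congr 1; field_simp; ring
      rw [h1]
      have h2 : X ^ (q - r - 1) ≤ Real.exp (-(q - r - 1)) := by
        calc X ^ (q - r - 1) ≤ Real.exp (-1) ^ (q - r - 1) :=
              Real.rpow_le_rpow hX0.le hXe (by linarith)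
          _ = _ := by rw [← Real.exp_mul]; congr 1; ring
      gcongr
    have h3 : T ^ (q / r - 1) * g * (S.card * Real.exp (1 - r)) ≤
        b * (Y / q) * S.card * Real.exp (2 - q) := by
      calc T ^ (q / r - 1) * g * (S.card * Real.exp (1 - r))
          ≤ Y / d * Real.exp (-(q - r - 1)) * g * (S.card * Real.exp (1 - r)) := by gcongr
        _ = b * (Y / q) * S.card * (Real.exp (-(q - r - 1)) * Real.exp (1 - r)) := by
            rw [hg]; field_simp
        _ = _ := by rw [← Real.exp_add]; congr 2; ring
    have h4 : 0 ≤ T ^ (q / r - 1) * g * (S.card * (Real.exp 1 * T)) := by positivity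
    have h2 : 2 * Real.exp 1 * b * agentPotential S r q d y =
        2 * (T ^ (q / r - 1) * g * (S.card * (Real.exp 1 * T))) := by
      rw [mul_assoc (2 * Real.exp 1), hpot]; ring
    linarith

theorem relMean_const (hS : S.Nonempty) : relMean S r d (fun _ => q) = (q / d) ^ r := by
  have hk : (S.card : ℝ) ≠ 0 := by exact_mod_cast hS.card_pos.ne'
  simp only [relMean, Finset.sum_const, nsmul_eq_mul]
  field_simp

theorem agentPrice_const (hS : S.Nonempty) (hr : 1 ≤ r) (hq : 0 < q) (hd : 0 < d) (e : E) :
    agentPrice S r q d (fun _ => q) e = (q / d) ^ (q - 1) := by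
  rw [agentPrice, relMean_const hS, ← Real.rpow_mul (by positivity),
    ← Real.rpow_add (by positivity)]
  congr 1
  have : r ≠ 0 := by linarith
  field_simp; ring

theorem agentPotential_const (hS : S.Nonempty) (hr : 1 ≤ r) (hq : 0 < q) (hd : 0 < d) :
    agentPotential S r q d (fun _ => q) = S.card * (q / d) ^ (q - 1) := by
  have hr0 : r ≠ 0 := by linarith
  have h1 : (q / d) ^ q = (q / d) ^ (q - 1) * (q / d) := by
    rw [← Real.rpow_add_one (by positivity)]; congr 1; ring
  rw [agentPotential, relMean_const hS, ← Real.rpow_mul (by positivity),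
    mul_div_cancel₀ _ hr0, h1]
  field_simp

/-- The contribution to `∑ e ∈ S, (y e / d) ^ r` of the edges with relative load above `2`. -/
noncomputable def heavySum (S : Finset E) (r d : ℝ) (y : E → ℝ) : ℝ :=
  ∑ e ∈ S, if 2 < y e / d then (y e / d) ^ r else 0

/-- Prices keep the heavy edges under control: while the mean is at most `1` everything grows
by at most the factor `(1 + 1 / q) ^ r`, and once it exceeds `1` only edges of relative load
below `1` are cheap enough to be used. -/
theorem heavySum_add_le (hS : S.Nonempty) (hr : 1 ≤ r) (hrq : r < q) (hd : 0 < d)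
    (hy : ∀ e, q ≤ y e) (x : E → ℝ) (hx0 : ∀ e, 0 ≤ x e) (hx1 : ∀ e, x e ≤ 1)
    (hx : ∀ e ∈ S, x e ≠ 0 → agentPrice S r q d y e ≤ 1)
    (h : heavySum S r d y ≤ Real.exp 1 * S.card) :
    heavySum S r d (fun e => y e + x e) ≤ Real.exp 1 * S.card := by
  have hq : 0 < q := by linarith
  have hr0 : 0 < r := by linarith
  have hk : (0 : ℝ) < S.card := by exact_mod_cast hS.card_pos
  have hy0 : ∀ e, 0 < y e := fun e => hq.trans_le (hy e)
  have hy'0 : ∀ e, 0 < y e + x e := fun e => by have := hy0 e; have := hx0 e; linarith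
  rcases le_or_gt (relMean S r d y) 1 with hT | hT
  · have hyγ : ∀ e, y e + x e ≤ (1 + 1 / q) * y e := fun e => by
      have h1 : 1 ≤ 1 / q * y e := by
        rw [one_div, inv_mul_eq_div, one_le_div hq]; exact hy e
      have := hx1 e
      linarith
    have h1 := relMean_le_mul (S := S) (γ := 1 + 1 / q) (by positivity) hr hd hy0 hy'0 hyγ
    have h2 := Real.one_add_inv_rpow_le hq hrq.le
    have h3 : relMean S r d (fun e => y e + x e) ≤ Real.exp 1 := by
      refine h1.trans ?_
      have := relMean_pos (r := r) hS hd hy0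
      calc (1 + 1 / q) ^ r * relMean S r d y ≤ Real.exp 1 * 1 := by gcongr
        _ = _ := mul_one _
    calc heavySum S r d (fun e => y e + x e)
        ≤ ∑ e ∈ S, ((y e + x e) / d) ^ r := by
          refine Finset.sum_le_sum fun e _ => ?_
          split_ifs
          · exact le_rfl
          · have := hy'0 e; positivity
      _ = relMean S r d (fun e => y e + x e) * S.card := (relMean_mul_card hS).symm
      _ ≤ _ := by gcongr
  · refine le_trans (Finset.sum_le_sum fun e he => ?_) h
    by_cases hxe : x e = 0
    · simp [hxe]
    · have hp := hx e he hxe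
      have hT1 : 1 < relMean S r d y ^ (q / r - 1) := by
        refine Real.one_lt_rpow hT ?_
        rw [sub_pos, one_lt_div hr0]; exact hrq
      have hye := hy0 e
      have hw : y e / d < 1 := by
        by_contra hcon
        -- this also covers `r = 1`, where the power is `1` and no edge at all is cheap
        have h1 : 1 ≤ (y e / d) ^ (r - 1) := Real.one_le_rpow (not_lt.1 hcon) (by linarith)
        rw [agentPrice] at hp
        nlinarith
      have hw2 : ¬ 2 < (y e + x e) / d := by
        have h1 : y e + x e ≤ 2 * y e := by
          have := hx1 e; have := hy e; linarith
        rw [not_lt]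
        calc (y e + x e) / d ≤ 2 * y e / d := by gcongr
          _ = 2 * (y e / d) := by ring
          _ ≤ 2 := by linarith
      simp only [hw2, if_false]
      split_ifs <;> positivity

theorem sum_rpow_le_of_heavySum_le (hr : 1 ≤ r) (hd : 0 < d) (hy : ∀ e, 0 < y e)
    (h : heavySum S r d y ≤ Real.exp 1 * S.card) :
    ∑ e ∈ S, (y e / d) ^ r ≤ 8 ^ r * S.card := by
  have he : Real.exp 1 < 3 := by have := Real.exp_one_lt_d9; linarith
  have h2 : (2 : ℝ) ≤ 2 ^ r := by
    calc (2 : ℝ) = 2 ^ (1 : ℝ) := by simp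
      _ ≤ 2 ^ r := Real.rpow_le_rpow_of_exponent_le (by norm_num) hr
  have h4 : (4 : ℝ) ≤ 4 ^ r := by
    calc (4 : ℝ) = 4 ^ (1 : ℝ) := by simp
      _ ≤ 4 ^ r := Real.rpow_le_rpow_of_exponent_le (by norm_num) hr
  have h8 : (8 : ℝ) ^ r = 2 ^ r * 4 ^ r := by
    rw [← Real.mul_rpow (by norm_num) (by norm_num)]; norm_num
  calc ∑ e ∈ S, (y e / d) ^ r
      ≤ ∑ e ∈ S, ((if 2 < y e / d then (y e / d) ^ r else 0) + 2 ^ r) := by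
        refine Finset.sum_le_sum fun e _ => ?_
        have := hy e
        split_ifs with h'
        · have : (0 : ℝ) ≤ 2 ^ r := by positivity
          linarith
        · rw [zero_add]
          exact Real.rpow_le_rpow (by positivity) (not_lt.1 h') (by linarith)
    _ = heavySum S r d y + 2 ^ r * S.card := by
        rw [Finset.sum_add_distrib, Finset.sum_const, nsmul_eq_mul, mul_comm (S.card : ℝ)]; rfl
    _ ≤ Real.exp 1 * S.card + 2 ^ r * S.card := by gcongr
    _ = (Real.exp 1 + 2 ^ r) * S.card := by ring
    _ ≤ _ := by
        gcongr
        rw [h8]; nlinarith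

end Agent

/-! ### Sequences of routing decisions -/

section Decisions

variable {E : Type*}

open Classical in
/-- The load that a single routing decision puts on the edge `e`. -/
noncomputable def decisionLoad (o : Option (List E)) (e : E) : ℕ :=
  if ∃ P, o = some P ∧ e ∈ P then 1 else 0

/-- `1` if the request is served, and `0` otherwise. -/
def decisionServed (o : Option (List E)) : ℕ := if o.isSome then 1 else 0

/-- The load that the first `i` decisions put on the edge `e`. -/
noncomputable def prefixLoad (p : ℕ → Option (List E)) (i : ℕ) (e : E) : ℕ :=
  ∑ k ∈ Finset.range i, decisionLoad (p k) e

/-- The number of requests served by the first `i` decisions. -/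
def prefixServed (p : ℕ → Option (List E)) (i : ℕ) : ℕ :=
  ∑ k ∈ Finset.range i, decisionServed (p k)

@[simp] theorem decisionLoad_none (e : E) : decisionLoad none e = 0 := by simp [decisionLoad]

@[simp] theorem decisionServed_none : decisionServed (none : Option (List E)) = 0 := rfl

@[simp] theorem decisionServed_some (P : List E) : decisionServed (some P) = 1 := rfl

theorem decisionLoad_le_one (o : Option (List E)) (e : E) : decisionLoad o e ≤ 1 := by
  unfold decisionLoad; split_ifs <;> simp

theorem decisionLoad_le_decisionServed (o : Option (List E)) (e : E) :
    decisionLoad o e ≤ decisionServed o := by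
  cases o with
  | none => simp
  | some P => simpa using decisionLoad_le_one _ _

variable (p : ℕ → Option (List E))

theorem prefixLoad_succ (i : ℕ) (e : E) :
    prefixLoad p (i + 1) e = prefixLoad p i e + decisionLoad (p i) e :=
  Finset.sum_range_succ _ _

theorem prefixServed_succ (i : ℕ) :
    prefixServed p (i + 1) = prefixServed p i + decisionServed (p i) :=
  Finset.sum_range_succ _ _

theorem prefixLoad_le_prefixServed (i : ℕ) (e : E) : prefixLoad p i e ≤ prefixServed p i :=
  Finset.sum_le_sum fun _ _ => decisionLoad_le_decisionServed _ _

theorem prefixLoad_mono {i j : ℕ} (h : i ≤ j) (e : E) : prefixLoad p i e ≤ prefixLoad p j e :=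
  Finset.sum_le_sum_of_subset (Finset.range_mono h)

theorem prefixServed_mono {i j : ℕ} (h : i ≤ j) : prefixServed p i ≤ prefixServed p j :=
  Finset.sum_le_sum_of_subset (Finset.range_mono h)

/-- If every request served by `R` and rejected by `p` is charged at least `1` by edge prices `π`,
then `R` serves at most the number of requests served by `p` plus the total price of `R`. -/
theorem prefixServed_le_add_sum [Fintype E] {R : ℕ → Option (List E)} {n : ℕ} {π : E → ℝ}
    (hπ : ∀ e, 0 ≤ π e)
    (h : ∀ k < n, R k ≠ none → p k = none → 1 ≤ ∑ e, π e * decisionLoad (R k) e) :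
    (prefixServed R n : ℝ) ≤ prefixServed p n + ∑ e, π e * prefixLoad R n e := by
  have hsum : ∑ e, π e * (prefixLoad R n e : ℝ) =
      ∑ k ∈ Finset.range n, ∑ e, π e * decisionLoad (R k) e := by
    rw [Finset.sum_comm]
    refine Finset.sum_congr rfl fun e _ => ?_
    rw [prefixLoad, Nat.cast_sum, Finset.mul_sum]
  rw [hsum, prefixServed, prefixServed, Nat.cast_sum, Nat.cast_sum, ← Finset.sum_add_distrib]
  refine Finset.sum_le_sum fun k hk => ?_
  have h0 : 0 ≤ ∑ e, π e * (decisionLoad (R k) e : ℝ) :=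
    Finset.sum_nonneg fun e _ => mul_nonneg (hπ e) (Nat.cast_nonneg _)
  have hk' := h k (Finset.mem_range.1 hk)
  cases hR : R k with
  | none => simp
  | some P =>
    rw [hR] at h0 hk'
    cases hp : p k with
    | none => simpa using hk' (by simp) hp
    | some P' => simpa using h0

end Decisions

/-! ### Prices of a family of agents -/

/-- A family of agents with sets `S j`, norm exponents `r j` and capacities that are, up to a
common factor, `d j` per edge, subject to the quantitative conditions under which
the price-based routing works. The number `q` is the degree of the potential, and
also the number of requests that together make up one unit of bandwidth. -/
structure AgentFamily (E J : Type*) [Fintype E] [Fintype J] where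
  S : J → Finset E
  r : J → ℝ
  d : J → ℝ
  q : ℝ
  M : ℝ
  nonempty : ∀ j, (S j).Nonempty
  one_le_r : ∀ j, 1 ≤ r j
  r_add_one_le : ∀ j, r j + 1 ≤ q
  two_le_q : 2 ≤ q
  d_pos : ∀ j, 0 < d j
  q_le_d : ∀ j, q / d j ≤ Real.exp (-1)
  card_agents_le : (Fintype.card J : ℝ) ≤ M
  card_edges_le : (Fintype.card E : ℝ) ≤ M
  sq_mul_exp_le : M ^ 2 * Real.exp (2 - q) ≤ 1

namespace AgentFamily

variable {E J : Type*} [Fintype E] [Fintype J] (F : AgentFamily E J)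

open Classical in
/-- The price of an edge: the sum of the prices charged by its owners. -/
noncomputable def edgePrice (y : E → ℝ) (e : E) : ℝ :=
  ∑ j, if e ∈ F.S j then agentPrice (F.S j) (F.r j) F.q (F.d j) y e else 0

/-- The sum of the potentials of the agents. -/
noncomputable def potential (y : E → ℝ) : ℝ :=
  ∑ j, agentPotential (F.S j) (F.r j) F.q (F.d j) y

/-- The loads on which prices are based are shifted by `q`, so that serving one more
request changes them by a factor of at most `1 + 1 / q`. -/
noncomputable def shiftedLoad (n : E → ℕ) (e : E) : ℝ := F.q + n e

variable {F}

theorem q_pos : 0 < F.q := by have := F.two_le_q; linarith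

theorem le_shiftedLoad (n : E → ℕ) (e : E) : F.q ≤ F.shiftedLoad n e := by
  simp [shiftedLoad]

theorem shiftedLoad_pos (n : E → ℕ) (e : E) : 0 < F.shiftedLoad n e :=
  q_pos.trans_le (le_shiftedLoad n e)

theorem sum_edgePrice_mul (y x : E → ℝ) :
    ∑ e, F.edgePrice y e * x e =
      ∑ j, ∑ e ∈ F.S j, agentPrice (F.S j) (F.r j) F.q (F.d j) y e * x e := by
  classical
  simp only [edgePrice, Finset.sum_mul]
  rw [Finset.sum_comm]
  refine Finset.sum_congr rfl fun j _ => ?_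
  rw [← Finset.sum_filter_add_sum_filter_not Finset.univ (fun e => e ∈ F.S j)]
  rw [Finset.sum_congr rfl (g := fun e => agentPrice (F.S j) (F.r j) F.q (F.d j) y e * x e)
    (fun e he => by rw [if_pos (Finset.mem_filter.1 he).2])]
  rw [Finset.sum_eq_zero (s := Finset.univ.filter fun e => ¬ e ∈ F.S j)
    (fun e he => by rw [if_neg (Finset.mem_filter.1 he).2, zero_mul]), add_zero]
  congr 1
  ext e; simp

theorem edgePrice_nonneg {y : E → ℝ} (hy : ∀ e, 0 < y e) (e : E) : 0 ≤ F.edgePrice y e := by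
  unfold edgePrice
  refine Finset.sum_nonneg fun j _ => ?_
  split_ifs
  · exact agentPrice_nonneg (F.nonempty j) (F.d_pos j) hy e
  · exact le_rfl

theorem edgePrice_mono {y y' : E → ℝ} (hy : ∀ e, 0 < y e) (h : ∀ e, y e ≤ y' e) (e : E) :
    F.edgePrice y e ≤ F.edgePrice y' e := by
  unfold edgePrice
  refine Finset.sum_le_sum fun j _ => ?_
  split_ifs
  · exact agentPrice_mono (F.nonempty j) (F.one_le_r j) (by linarith [F.r_add_one_le j])
      (F.d_pos j) hy h e
  · exact le_rfl

theorem card_S_le (j : J) : ((F.S j).card : ℝ) ≤ F.M :=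
  le_trans (by exact_mod_cast Finset.card_le_univ _) F.card_edges_le

theorem sum_card_le : ∑ j, ((F.S j).card : ℝ) ≤ F.M ^ 2 := by
  have hM : 0 ≤ F.M := le_trans (Nat.cast_nonneg _) F.card_edges_le
  calc ∑ j, ((F.S j).card : ℝ) ≤ ∑ _j : J, F.M := Finset.sum_le_sum fun j _ => card_S_le j
    _ = Fintype.card J * F.M := by simp
    _ ≤ F.M * F.M := by gcongr; exact F.card_agents_le
    _ = _ := by ring

theorem rpow_sub_one_le (j : J) : (F.q / F.d j) ^ (F.q - 1) ≤ Real.exp (2 - F.q) := by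
  have h1 := F.d_pos j
  have h2 := F.two_le_q
  have h3 := q_pos (F := F)
  calc (F.q / F.d j) ^ (F.q - 1) ≤ Real.exp (-1) ^ (F.q - 1) :=
        Real.rpow_le_rpow (by positivity) (F.q_le_d j) (by linarith)
    _ = Real.exp (-1 * (F.q - 1)) := by rw [← Real.exp_mul]
    _ ≤ _ := by gcongr; linarith

theorem sum_card_mul_rpow_le :
    ∑ j, ((F.S j).card : ℝ) * (F.q / F.d j) ^ (F.q - 1) ≤ 1 := by
  calc ∑ j, ((F.S j).card : ℝ) * (F.q / F.d j) ^ (F.q - 1)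
      ≤ ∑ j, ((F.S j).card : ℝ) * Real.exp (2 - F.q) := by
        gcongr with j _; exact rpow_sub_one_le j
    _ = (∑ j, ((F.S j).card : ℝ)) * Real.exp (2 - F.q) := by rw [Finset.sum_mul]
    _ ≤ F.M ^ 2 * Real.exp (2 - F.q) := by gcongr; exact sum_card_le
    _ ≤ 1 := F.sq_mul_exp_le

theorem potential_const_le : F.potential (fun _ => F.q) ≤ 1 := by
  refine le_trans (le_of_eq ?_) (sum_card_mul_rpow_le (F := F))
  exact Finset.sum_congr rfl fun j _ =>
    agentPotential_const (F.nonempty j) (F.one_le_r j) q_pos (F.d_pos j)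

/-- As long as nothing has been served, every path is cheap. -/
theorem sum_edgePrice_const_mul_le (x : E → ℝ) (hx1 : ∀ e, x e ≤ 1) :
    ∑ e, F.edgePrice (fun _ => F.q) e * x e ≤ 1 := by
  rw [sum_edgePrice_mul]
  refine le_trans (Finset.sum_le_sum fun j _ => ?_) (sum_card_mul_rpow_le (F := F))
  rw [← nsmul_eq_mul, ← Finset.sum_const]
  refine Finset.sum_le_sum fun e _ => ?_
  rw [agentPrice_const (F.nonempty j) (F.one_le_r j) q_pos (F.d_pos j)]
  have h1 := F.d_pos j
  have h3 := q_pos (F := F)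
  exact mul_le_of_le_one_right (by positivity) (hx1 e)

theorem potential_add_le {y : E → ℝ} (hy : ∀ e, F.q ≤ y e) (x : E → ℝ) (hx0 : ∀ e, 0 ≤ x e)
    (hx1 : ∀ e, x e ≤ 1) :
    F.potential (fun e => y e + x e) ≤
      F.potential y + Real.exp 1 * ∑ e, F.edgePrice y e * x e := by
  rw [sum_edgePrice_mul, Finset.mul_sum, potential, potential, ← Finset.sum_add_distrib]
  exact Finset.sum_le_sum fun j _ => agentPotential_add_le (F.nonempty j) (F.one_le_r j)
    (by linarith [F.r_add_one_le j]) (F.d_pos j) hy x hx0 hx1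

/-- A load vector that respects all capacities costs little more than the potential. -/
theorem sum_edgePrice_mul_le {y : E → ℝ} (hy : ∀ e, 0 < y e) {b Y : ℝ} (hb : 0 < b)
    (hY0 : 0 ≤ Y) (hY : ∀ e, y e ≤ Y) (μ : E → ℝ) (hμ0 : ∀ e, 0 ≤ μ e)
    (hμ : ∀ j, ∑ e ∈ F.S j, (μ e / (b * F.d j / F.q)) ^ F.r j ≤ (F.S j).card) :
    ∑ e, F.edgePrice y e * μ e ≤ 2 * Real.exp 1 * b * F.potential y + b * (Y / F.q) := by
  have hq := q_pos (F := F)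
  rw [sum_edgePrice_mul]
  calc ∑ j, ∑ e ∈ F.S j, agentPrice (F.S j) (F.r j) F.q (F.d j) y e * μ e
      ≤ ∑ j, (2 * Real.exp 1 * b * agentPotential (F.S j) (F.r j) F.q (F.d j) y
          + b * (Y / F.q) * (F.S j).card * Real.exp (2 - F.q)) :=
        Finset.sum_le_sum fun j _ => sum_agentPrice_mul_le (F.nonempty j) (F.one_le_r j)
          (F.r_add_one_le j) (F.d_pos j) hy hb hY μ hμ0 (hμ j)
    _ = 2 * Real.exp 1 * b * F.potential y
          + b * (Y / F.q) * ((∑ j, ((F.S j).card : ℝ)) * Real.exp (2 - F.q)) := by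
        rw [Finset.sum_add_distrib, ← Finset.mul_sum, ← Finset.sum_mul, ← Finset.mul_sum,
          potential]
        ring
    _ ≤ 2 * Real.exp 1 * b * F.potential y + b * (Y / F.q) * 1 := by
        gcongr
        refine le_trans ?_ F.sq_mul_exp_le
        gcongr
        exact sum_card_le
    _ = _ := by rw [mul_one]

/-! ### Routing along cheap paths -/

variable {p : ℕ → Option (List E)}

theorem shiftedLoad_zero : F.shiftedLoad (prefixLoad p 0) = fun _ => F.q := by
  funext e; simp [shiftedLoad, prefixLoad]

theorem shiftedLoad_succ (i : ℕ) : F.shiftedLoad (prefixLoad p (i + 1)) =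
    fun e => F.shiftedLoad (prefixLoad p i) e + (decisionLoad (p i) e : ℝ) := by
  funext e; simp [shiftedLoad, prefixLoad_succ, add_assoc]

theorem shiftedLoad_mono {i j : ℕ} (h : i ≤ j) (e : E) :
    F.shiftedLoad (prefixLoad p i) e ≤ F.shiftedLoad (prefixLoad p j) e := by
  have := prefixLoad_mono p h e
  simp only [shiftedLoad]; gcongr

theorem potential_prefixLoad_le
    (hp : ∀ k, ∑ e, F.edgePrice (F.shiftedLoad (prefixLoad p k)) e * decisionLoad (p k) e ≤ 1)
    (i : ℕ) : F.potential (F.shiftedLoad (prefixLoad p i)) ≤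
      1 + Real.exp 1 * prefixServed p i := by
  induction i with
  | zero => rw [shiftedLoad_zero]; simpa [prefixServed] using potential_const_le
  | succ i ih =>
    have h1 := potential_add_le (F := F) (le_shiftedLoad (prefixLoad p i))
      (fun e => (decisionLoad (p i) e : ℝ)) (fun e => Nat.cast_nonneg _)
      (fun e => by exact_mod_cast decisionLoad_le_one _ _)
    have h2 : ∑ e, F.edgePrice (F.shiftedLoad (prefixLoad p i)) e * (decisionLoad (p i) e : ℝ)
        ≤ decisionServed (p i) := by
      have := hp i
      cases h : p i with
      | none => simp
      | some P => rw [h] at this; simpa using this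
    have h3 : Real.exp 1 * ∑ e, F.edgePrice (F.shiftedLoad (prefixLoad p i)) e *
        (decisionLoad (p i) e : ℝ) ≤ Real.exp 1 * decisionServed (p i) := by gcongr
    rw [shiftedLoad_succ, prefixServed_succ]
    push_cast
    linarith

theorem sum_shiftedLoad_rpow_le
    (hp : ∀ k, ∑ e, F.edgePrice (F.shiftedLoad (prefixLoad p k)) e * decisionLoad (p k) e ≤ 1)
    (i : ℕ) (j : J) :
    ∑ e ∈ F.S j, (F.shiftedLoad (prefixLoad p i) e / F.d j) ^ F.r j ≤
      8 ^ F.r j * (F.S j).card := by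
  have hd := F.d_pos j
  refine sum_rpow_le_of_heavySum_le (F.one_le_r j) hd (shiftedLoad_pos _) ?_
  induction i with
  | zero =>
    have h1 : ¬ 2 < F.q / F.d j := by
      have := F.q_le_d j
      have : Real.exp (-1) ≤ 1 := Real.exp_le_one_iff.2 (by norm_num)
      linarith
    rw [shiftedLoad_zero]
    simp only [heavySum, h1, if_false, Finset.sum_const_zero]
    positivity
  | succ i ih =>
    rw [shiftedLoad_succ]
    refine heavySum_add_le (F.nonempty j) (F.one_le_r j) (by linarith [F.r_add_one_le j]) hd
      (le_shiftedLoad _) _ (fun e => Nat.cast_nonneg _)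
      (fun e => by exact_mod_cast decisionLoad_le_one _ _) ?_ ih
    intro e he hne
    have h1 : decisionLoad (p i) e = 1 := by
      have h2 := decisionLoad_le_one (p i) e
      have h3 : decisionLoad (p i) e ≠ 0 := by exact_mod_cast hne
      omega
    set y := F.shiftedLoad (prefixLoad p i) with hy
    have hy0 : ∀ e, 0 < y e := shiftedLoad_pos _
    calc agentPrice (F.S j) (F.r j) F.q (F.d j) y e
        ≤ F.edgePrice y e := by
          classical
          unfold edgePrice
          refine le_trans (le_of_eq ?_) (Finset.single_le_sum (f := fun j => if e ∈ F.S j then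
            agentPrice (F.S j) (F.r j) F.q (F.d j) y e else 0) (fun j _ => ?_)
            (Finset.mem_univ j))
          · rw [if_pos he]
          · split_ifs
            · exact agentPrice_nonneg (F.nonempty j) (F.d_pos j) hy0 e
            · exact le_rfl
      _ = F.edgePrice y e * (decisionLoad (p i) e : ℝ) := by rw [h1]; simp
      _ ≤ ∑ e, F.edgePrice y e * (decisionLoad (p i) e : ℝ) :=
          Finset.single_le_sum (f := fun e => F.edgePrice y e * (decisionLoad (p i) e : ℝ))
            (fun e _ => mul_nonneg (edgePrice_nonneg hy0 e) (Nat.cast_nonneg _))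
            (Finset.mem_univ e)
      _ ≤ 1 := hp i

/-- Serving every request that has a cheap path is constant-competitive: the offline requests that
were rejected pay at least `1` each at the final prices, hence number at most a constant times
the final potential, to which every served request contributed at most a constant. -/
theorem prefixServed_le_of_cheap
    (hp : ∀ k, ∑ e, F.edgePrice (F.shiftedLoad (prefixLoad p k)) e * decisionLoad (p k) e ≤ 1)
    {R : ℕ → Option (List E)} {n : ℕ}
    (hR : ∀ k < n, R k ≠ none → p k = none →
      1 < ∑ e, F.edgePrice (F.shiftedLoad (prefixLoad p k)) e * decisionLoad (R k) e)
    {b : ℝ} (hb : 0 < b)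
    (hcap : ∀ j, ∑ e ∈ F.S j, ((prefixLoad R n e : ℝ) / (b * F.d j / F.q)) ^ F.r j ≤
      (F.S j).card) :
    (prefixServed R n : ℝ) ≤ (1 + 26 * b) * prefixServed p n := by
  rcases Nat.eq_zero_or_pos (prefixServed p n) with h0 | hpos
  -- the first request that has an admissible path is served, because all paths are cheap initially
  · have hRnone : ∀ k < n, R k = none := by
      intro k hk
      by_contra hne
      have hk1 : prefixServed p (k + 1) ≤ 0 := h0 ▸ prefixServed_mono p hk
      rw [prefixServed_succ] at hk1
      have hpk : p k = none := by
        cases h : p k with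
        | none => rfl
        | some P => rw [h, decisionServed_some] at hk1; omega
      have hload : F.shiftedLoad (prefixLoad p k) = fun _ => F.q := by
        funext e
        have h2 := prefixLoad_le_prefixServed p k e
        have h3 : prefixLoad p k e = 0 := by omega
        simp [shiftedLoad, h3]
      have h1 := hR k hk hne hpk
      rw [hload] at h1
      have h2 := sum_edgePrice_const_mul_le (F := F) (fun e => (decisionLoad (R k) e : ℝ))
        (fun e => by exact_mod_cast decisionLoad_le_one _ _)
      exact absurd h1 (not_lt.2 h2)
    have : prefixServed R n = 0 :=
      Finset.sum_eq_zero fun k hk => by rw [hRnone k (Finset.mem_range.1 hk)]; rfl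
    simp [this, h0]
  · have hn1 : (1 : ℝ) ≤ prefixServed p n := by exact_mod_cast hpos
    set s : ℝ := (prefixServed p n : ℝ) with hs
    set y := F.shiftedLoad (prefixLoad p n) with hy
    have hy0 : ∀ e, 0 < y e := shiftedLoad_pos _
    have hq := q_pos (F := F)
    have hq2 := F.two_le_q
    have h1 := prefixServed_le_add_sum p (R := R) (n := n) (π := F.edgePrice y)
      (fun e => edgePrice_nonneg hy0 e) (fun k hk hRk hpk => by
        refine (hR k hk hRk hpk).le.trans (Finset.sum_le_sum fun e _ => ?_)
        refine mul_le_mul_of_nonneg_right ?_ (Nat.cast_nonneg _)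
        exact edgePrice_mono (shiftedLoad_pos _) (shiftedLoad_mono hk.le) e)
    have h2 := sum_edgePrice_mul_le (F := F) (y := y) hy0 hb (Y := F.q + s) (by positivity)
      (fun e => by
        have : (prefixLoad p n e : ℝ) ≤ s := by
          rw [hs]; exact_mod_cast prefixLoad_le_prefixServed p n e
        simp only [hy, shiftedLoad]; linarith)
      (fun e => (prefixLoad R n e : ℝ)) (fun e => Nat.cast_nonneg _) hcap
    have h3 := potential_prefixLoad_le (F := F) hp n
    rw [← hy, ← hs] at h3
    have he : Real.exp 1 ≤ 3 := by have := Real.exp_one_lt_d9; linarith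
    have hpot : F.potential y ≤ 4 * s := by
      have : Real.exp 1 * s ≤ 3 * s := by gcongr
      linarith
    have h4 : 2 * Real.exp 1 * b * F.potential y ≤ 2 * 3 * b * (4 * s) := by
      calc 2 * Real.exp 1 * b * F.potential y ≤ 2 * Real.exp 1 * b * (4 * s) := by gcongr
        _ ≤ 2 * 3 * b * (4 * s) := by gcongr
    have h5 : (F.q + s) / F.q ≤ 2 * s := by
      rw [div_le_iff₀ hq]; nlinarith
    have h6 : b * ((F.q + s) / F.q) ≤ b * (2 * s) := by gcongr
    linarith

end AgentFamily

/-! ### Thinning a routing -/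

section Thinning

variable {E : Type*} [Fintype E]

/-- Pessimistic estimator for the overload of the edge `e`, if `n` is the load before and `a` the
load after a thinning of the requests by the factor `q`. -/
noncomputable def overload (q : ℝ) (n a : E → ℕ) (e : E) : ℝ :=
  Real.exp (a e - 2 / q * n e) / Fintype.card E

/-- `a` arises from `p` by thinning: a request served by `p` is kept if its path has
small total overload at that time. -/
def IsThinning (q : ℝ) (p a : ℕ → Option (List E)) : Prop :=
  ∀ k, (∑ e, overload q (prefixLoad p k) (prefixLoad a k) e * decisionLoad (p k) e ≤ 1 ∧
      a k = p k) ∨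
    (1 < ∑ e, overload q (prefixLoad p k) (prefixLoad a k) e * decisionLoad (p k) e ∧
      a k = none)

variable {q : ℝ} {p a : ℕ → Option (List E)}

theorem overload_nonneg (n a : E → ℕ) (e : E) : 0 ≤ overload q n a e := by
  unfold overload; positivity

theorem IsThinning.prefixLoad_le [Nonempty E] (h : IsThinning q p a) (hq : 2 ≤ q) (i : ℕ)
    (e : E) : (prefixLoad a i e : ℝ) ≤
      2 / q * prefixLoad p i e + (Real.log (Fintype.card E) + 1) := by
  have hm : (1 : ℝ) ≤ Fintype.card E := by exact_mod_cast Fintype.card_pos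
  have hlog := Real.log_nonneg hm
  have hq0 : 0 ≤ 2 / q := by positivity
  induction i with
  | zero => simp only [prefixLoad, Finset.range_zero, Finset.sum_empty]; simp; linarith
  | succ i ih =>
    rw [prefixLoad_succ, prefixLoad_succ]
    push_cast
    have hp0 : (0 : ℝ) ≤ decisionLoad (p i) e := Nat.cast_nonneg _
    have hmul : 0 ≤ 2 / q * (decisionLoad (p i) e : ℝ) := by positivity
    by_cases hz : decisionLoad (a i) e = 0
    · rw [hz]; push_cast; linarith
    · rcases h i with ⟨h1, h2⟩ | ⟨_, h2⟩
      · rw [h2] at hz ⊢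
        have hone : decisionLoad (p i) e = 1 := by
          have := decisionLoad_le_one (p i) e; omega
        have h3 : overload q (prefixLoad p i) (prefixLoad a i) e ≤ 1 := by
          refine le_trans ?_ h1
          refine le_trans (le_of_eq ?_) (Finset.single_le_sum
            (f := fun e => overload q (prefixLoad p i) (prefixLoad a i) e *
              (decisionLoad (p i) e : ℝ))
            (fun e _ => mul_nonneg (overload_nonneg _ _ e) (Nat.cast_nonneg _))
            (Finset.mem_univ e))
          simp [hone]
        rw [overload, div_le_one (by linarith), ← Real.le_log_iff_exp_le (by linarith)] at h3
        rw [hone] at hmul ⊢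
        push_cast at hmul ⊢
        linarith
      · rw [h2] at hz; simp at hz

theorem Real.exp_neg_le_one_sub_half {x : ℝ} (h0 : 0 ≤ x) (h1 : x ≤ 1) :
    Real.exp (-x) ≤ 1 - x / 2 := by
  have h2 := Real.add_one_le_exp x
  rw [Real.exp_neg, inv_le_comm₀ (Real.exp_pos x) (by linarith)]
  refine le_trans ?_ h2
  rw [inv_le_iff_one_le_mul₀ (by linarith)]
  nlinarith

/-- The total overload rises by at most `2` when a request is kept, and drops by at least `1 / q` when
one is discarded. -/
theorem IsThinning.sum_overload_le [Nonempty E] (h : IsThinning q p a) (hq : 2 ≤ q) (i : ℕ) :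
    ∑ e, overload q (prefixLoad p i) (prefixLoad a i) e +
      ((prefixServed p i : ℝ) - prefixServed a i) / q ≤ 1 + 2 * prefixServed a i := by
  have hq0 : 0 < q := by linarith
  have hm : (Fintype.card E : ℝ) ≠ 0 := by exact_mod_cast Fintype.card_ne_zero
  induction i with
  | zero => simp [overload, prefixLoad, prefixServed, hm]
  | succ i ih =>
    set φ := overload q (prefixLoad p i) (prefixLoad a i) with hφ
    have hφ0 : ∀ e, 0 ≤ φ e := overload_nonneg _ _
    have hstep : ∀ e, overload q (prefixLoad p (i + 1)) (prefixLoad a (i + 1)) e =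
        φ e * Real.exp (decisionLoad (a i) e - 2 / q * decisionLoad (p i) e) := by
      intro e
      simp only [hφ, overload]
      rw [prefixLoad_succ, prefixLoad_succ, div_mul_eq_mul_div (Real.exp _), ← Real.exp_add]
      push_cast
      congr 2; ring
    have h01 : ∀ e, decisionLoad (p i) e = 0 ∨ decisionLoad (p i) e = 1 := fun e => by
      have := decisionLoad_le_one (p i) e; omega
    rw [prefixServed_succ, prefixServed_succ]
    simp only [hstep]
    rcases h i with ⟨h1, h2⟩ | ⟨h1, h2⟩
    · have hle : ∑ e, φ e * Real.exp (decisionLoad (a i) e - 2 / q * decisionLoad (p i) e) ≤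
          ∑ e, φ e + 2 * decisionServed (a i) := by
        have hb : ∑ e, φ e * Real.exp (decisionLoad (a i) e - 2 / q * decisionLoad (p i) e) ≤
            ∑ e, φ e + 2 * ∑ e, φ e * decisionLoad (p i) e := by
          rw [Finset.mul_sum, ← Finset.sum_add_distrib]
          refine Finset.sum_le_sum fun e _ => ?_
          rw [h2]
          have := hφ0 e
          rcases h01 e with h3 | h3
          · simp [h3]
          · have hexp : Real.exp (1 - 2 / q) ≤ 3 := by
              calc Real.exp (1 - 2 / q) ≤ Real.exp 1 := by
                    gcongr; have : 0 ≤ 2 / q := by positivity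
                    linarith
                _ ≤ 3 := by have := Real.exp_one_lt_d9; linarith
            rw [h3]; push_cast; rw [mul_one, mul_one]
            nlinarith
        have hc : ∑ e, φ e * (decisionLoad (p i) e : ℝ) ≤ decisionServed (p i) := by
          cases hpi : p i with
          | none => simp
          | some P => rw [hpi] at h1; simpa using h1
        rw [h2] at hb ⊢
        linarith
      rw [h2] at hle ⊢
      push_cast
      have : ((prefixServed p i : ℝ) + decisionServed (p i) -
        (prefixServed a i + decisionServed (p i))) = prefixServed p i - prefixServed a i := by
          ring
      rw [this]
      linarith
    · have hle : ∑ e, φ e * Real.exp (decisionLoad (a i) e - 2 / q * decisionLoad (p i) e) ≤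
          ∑ e, φ e - 1 / q := by
        have hb : ∑ e, φ e * Real.exp (decisionLoad (a i) e - 2 / q * decisionLoad (p i) e) ≤
            ∑ e, φ e - 1 / q * ∑ e, φ e * decisionLoad (p i) e := by
          rw [Finset.mul_sum, ← Finset.sum_sub_distrib]
          refine Finset.sum_le_sum fun e _ => ?_
          rw [h2]
          have := hφ0 e
          rcases h01 e with h3 | h3
          · simp [h3]
          · have hexp := Real.exp_neg_le_one_sub_half (x := 2 / q) (by positivity)
              (by rw [div_le_one hq0]; exact hq)
            have h4 : φ e * Real.exp (-(2 / q)) ≤ φ e * (1 - 2 / q / 2) := by gcongr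
            rw [h3]
            simp only [decisionLoad_none, Nat.cast_zero, Nat.cast_one, mul_one, zero_sub]
            refine h4.trans (le_of_eq ?_)
            ring
        have hc : 1 / q * 1 ≤ 1 / q * ∑ e, φ e * (decisionLoad (p i) e : ℝ) := by gcongr
        linarith
      have hs : decisionServed (p i) ≤ 1 := by unfold decisionServed; split_ifs <;> simp
      have hs' : (decisionServed (p i) : ℝ) / q ≤ 1 / q := by
        gcongr; exact_mod_cast hs
      rw [h2] at hle ⊢
      push_cast
      rw [decisionServed_none, Nat.cast_zero, add_zero]
      have : ((prefixServed p i : ℝ) + decisionServed (p i) - prefixServed a i) / q =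
        (prefixServed p i - prefixServed a i) / q + decisionServed (p i) / q := by ring
      rw [this]
      linarith

/-- The first request that `p` serves is kept. -/
theorem IsThinning.prefixServed_eq_zero [Nonempty E] (h : IsThinning q p a) (i : ℕ)
    (hi : prefixServed a i = 0) : prefixServed p i = 0 := by
  have hm : (Fintype.card E : ℝ) ≠ 0 := by exact_mod_cast Fintype.card_ne_zero
  induction i with
  | zero => rfl
  | succ i ih =>
    rw [prefixServed_succ] at hi ⊢
    have ha : prefixServed a i = 0 := by omega
    have hp := ih ha
    rw [hp, zero_add]
    rcases h i with ⟨_, h2⟩ | ⟨h1, _⟩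
    · rw [← h2]; omega
    · exfalso
      refine absurd h1 (not_lt.2 ?_)
      calc ∑ e, overload q (prefixLoad p i) (prefixLoad a i) e * (decisionLoad (p i) e : ℝ)
          ≤ ∑ _e : E, (1 : ℝ) / Fintype.card E := by
            refine Finset.sum_le_sum fun e _ => ?_
            have h3 : prefixLoad p i e = 0 := by
              have := prefixLoad_le_prefixServed p i e; omega
            have h4 : prefixLoad a i e = 0 := by
              have := prefixLoad_le_prefixServed a i e; omega
            have h5 : overload q (prefixLoad p i) (prefixLoad a i) e = 1 / Fintype.card E := by
              simp [overload, h3, h4]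
            rw [h5]
            refine mul_le_of_le_one_right (by positivity) ?_
            exact_mod_cast decisionLoad_le_one _ _
        _ = 1 := by simp [hm]

theorem IsThinning.prefixServed_le [Nonempty E] (h : IsThinning q p a) (hq : 2 ≤ q) (i : ℕ) :
    (prefixServed p i : ℝ) ≤ 4 * q * prefixServed a i := by
  rcases Nat.eq_zero_or_pos (prefixServed a i) with h0 | hpos
  · rw [h.prefixServed_eq_zero i h0]; simp [h0]
  · have h1 : (1 : ℝ) ≤ prefixServed a i := by exact_mod_cast hpos
    have h2 := h.sum_overload_le hq i
    have h3 : 0 ≤ ∑ e, overload q (prefixLoad p i) (prefixLoad a i) e :=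
      Finset.sum_nonneg fun e _ => overload_nonneg _ _ e
    have h4 : ((prefixServed p i : ℝ) - prefixServed a i) / q ≤ 3 * prefixServed a i := by
      linarith
    rw [div_le_iff₀ (by linarith)] at h4
    nlinarith

end Thinning

/-! ### Norm constraints as power means -/

section Norms

variable {E : Type*}

/-- The exponent that is used in place of `p`: exponents above `s` are replaced by `s`. -/
noncomputable def truncExponent (s : ℝ) (p : ℝ≥0∞) : ℝ :=
  if p ≤ ENNReal.ofReal s then p.toReal else s

/-- The capacity per edge that goes with `truncExponent`, for a set of `k` edges whose loads have
to have `ℓ_p`-norm at most `c`. -/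
noncomputable def edgeCapacity (s : ℝ) (p : ℝ≥0∞) (c : ℝ) (k : ℕ) : ℝ :=
  if p ≤ ENNReal.ofReal s then c / (k : ℝ) ^ (1 / p.toReal) else c

variable {s c : ℝ} {p : ℝ≥0∞}

theorem one_le_toReal_of_le (hp : 1 ≤ p) (h : p ≤ ENNReal.ofReal s) : 1 ≤ p.toReal := by
  have := (ENNReal.toReal_le_toReal ENNReal.one_ne_top
    (ne_top_of_le_ne_top ENNReal.ofReal_ne_top h)).2 hp
  simpa using this

theorem one_le_truncExponent (hs : 1 ≤ s) (hp : 1 ≤ p) : 1 ≤ truncExponent s p := by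
  unfold truncExponent
  split_ifs with h
  · exact one_le_toReal_of_le hp h
  · exact hs

theorem truncExponent_le (hs : 0 ≤ s) : truncExponent s p ≤ s := by
  unfold truncExponent
  split_ifs with h
  · exact ENNReal.toReal_le_of_le_ofReal hs h
  · exact le_rfl

theorem le_edgeCapacity {a : ℝ} {k : ℕ} (hk : 1 ≤ k) (ha : 0 ≤ a)
    (h : a * (k : ℝ) ^ (1 / p.toReal) ≤ c) : a ≤ edgeCapacity s p c k := by
  have hk' : (1 : ℝ) ≤ k := by exact_mod_cast hk
  unfold edgeCapacity
  split_ifs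
  · rw [le_div_iff₀ (by positivity)]; exact h
  · refine le_trans ?_ h
    exact le_mul_of_one_le_right ha (Real.one_le_rpow hk' (by positivity))

theorem sum_div_edgeCapacity_rpow_le {S : Finset E} (hS : S.Nonempty) (hs : 1 ≤ s) (hp : 1 ≤ p)
    (hc : 0 < c) {f : E → ℝ} (hf : ∀ e, 0 ≤ f e)
    (h : ‖WithLp.toLp p (fun e : S => f e)‖ ≤ c) :
    ∑ e ∈ S, (f e / edgeCapacity s p c S.card) ^ truncExponent s p ≤ S.card := by
  have hk : (0 : ℝ) < S.card := by exact_mod_cast hS.card_pos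
  unfold edgeCapacity truncExponent
  split_ifs with hps
  · have hp1 := one_le_toReal_of_le hp hps
    have hp0 : 0 < p.toReal := by linarith
    rw [PiLp.norm_eq_sum hp0] at h
    have hsum : ∑ e : S, ‖f e‖ ^ p.toReal = ∑ e ∈ S, f e ^ p.toReal := by
      rw [← Finset.sum_coe_sort S]
      exact Finset.sum_congr rfl fun e _ => by rw [Real.norm_of_nonneg (hf e)]
    simp only [hsum] at h
    have hnn : 0 ≤ ∑ e ∈ S, f e ^ p.toReal :=
      Finset.sum_nonneg fun e _ => Real.rpow_nonneg (hf e) _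
    have h2 : ∑ e ∈ S, f e ^ p.toReal ≤ c ^ p.toReal := by
      rwa [one_div, Real.rpow_inv_le_iff_of_pos hnn hc.le hp0] at h
    have h3 : (c / (S.card : ℝ) ^ (1 / p.toReal)) ^ p.toReal = c ^ p.toReal / S.card := by
      rw [Real.div_rpow hc.le (by positivity), ← Real.rpow_mul hk.le,
        one_div_mul_cancel hp0.ne', Real.rpow_one]
    calc ∑ e ∈ S, (f e / (c / (S.card : ℝ) ^ (1 / p.toReal))) ^ p.toReal
        = (∑ e ∈ S, f e ^ p.toReal) / (c ^ p.toReal / S.card) := by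
          rw [Finset.sum_div]
          exact Finset.sum_congr rfl fun e _ => by
            rw [Real.div_rpow (hf e) (by positivity), h3]
      _ ≤ c ^ p.toReal / (c ^ p.toReal / S.card) := by gcongr
      _ = S.card := by
          have : c ^ p.toReal ≠ 0 := by positivity
          field_simp
  · have : Fact (1 ≤ p) := ⟨hp⟩
    calc ∑ e ∈ S, (f e / c) ^ s ≤ ∑ _e ∈ S, (1 : ℝ) := by
          refine Finset.sum_le_sum fun e he => ?_
          have h1 := PiLp.norm_apply_le (WithLp.toLp p (fun e : S => f e)) ⟨e, he⟩
          have h2 : f e ≤ c := by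
            refine le_trans (le_trans (le_abs_self _) ?_) h
            simpa using h1
          exact Real.rpow_le_one (div_nonneg (hf e) hc.le) ((div_le_one hc).2 h2) (by linarith)
      _ = S.card := by simp

theorem PiLp.norm_le_card_rpow_mul {ι : Type*} [Fintype ι] [Nonempty ι] (hp : 1 ≤ p)
    {f : ι → ℝ} {a : ℝ} (hf : ∀ i, ‖f i‖ ≤ a) :
    ‖WithLp.toLp p f‖ ≤ (Fintype.card ι : ℝ) ^ (1 / p.toReal) * a := by
  have ha : 0 ≤ a := (norm_nonneg _).trans (hf (Classical.arbitrary ι))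
  rcases eq_or_ne p ⊤ with rfl | htop
  · rw [PiLp.norm_eq_ciSup]
    simpa using ciSup_le hf
  · have hp0 : 0 < p.toReal := ENNReal.toReal_pos (zero_lt_one.trans_le hp).ne' htop
    rw [PiLp.norm_eq_sum hp0]
    calc (∑ i, ‖f i‖ ^ p.toReal) ^ (1 / p.toReal)
        ≤ (∑ _i : ι, a ^ p.toReal) ^ (1 / p.toReal) := by
          gcongr with i _; exact hf i
      _ = _ := by
          rw [Finset.sum_const, nsmul_eq_mul, Finset.card_univ,
            Real.mul_rpow (by positivity) (by positivity), ← Real.rpow_mul ha,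
            mul_one_div_cancel hp0.ne', Real.rpow_one]

/-- Loads whose truncated power mean is at most an eighth of the capacity per edge are feasible.
Where the exponent is truncated, the loads are bounded edge by edge; passing from the `ℓ_s`-norm to the
maximum and from there to the `ℓ_p`-norm costs a factor of at most `exp 1` each, since
`k ≤ exp s`. -/
theorem norm_le_of_sum_div_edgeCapacity_rpow_le {S : Finset E} (hS : S.Nonempty) (hs : 1 ≤ s)
    (hp : 1 ≤ p) (hc : 0 < c) (hcard : (S.card : ℝ) ≤ Real.exp s) {f : E → ℝ}
    (hf : ∀ e, 0 ≤ f e)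
    (h : ∑ e ∈ S, (f e / edgeCapacity s p c S.card) ^ truncExponent s p ≤
      (1 / 8) ^ truncExponent s p * S.card) :
    ‖WithLp.toLp p (fun e : S => f e)‖ ≤ c := by
  have hk : (0 : ℝ) < S.card := by exact_mod_cast hS.card_pos
  have hk1 : (1 : ℝ) ≤ S.card := by exact_mod_cast hS.card_pos
  unfold edgeCapacity truncExponent at h
  split_ifs at h with hps
  · have hp1 := one_le_toReal_of_le hp hps
    have hp0 : 0 < p.toReal := by linarith
    have h3 : (c / (S.card : ℝ) ^ (1 / p.toReal)) ^ p.toReal = c ^ p.toReal / S.card := by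
      rw [Real.div_rpow hc.le (by positivity), ← Real.rpow_mul hk.le,
        one_div_mul_cancel hp0.ne', Real.rpow_one]
    have h4 : ∑ e ∈ S, (f e / (c / (S.card : ℝ) ^ (1 / p.toReal))) ^ p.toReal
        = (∑ e ∈ S, f e ^ p.toReal) / (c ^ p.toReal / S.card) := by
      rw [Finset.sum_div]
      exact Finset.sum_congr rfl fun e _ => by
        rw [Real.div_rpow (hf e) (by positivity), h3]
    have h5 : ((1 : ℝ) / 8) ^ p.toReal ≤ 1 :=
      Real.rpow_le_one (by norm_num) (by norm_num) hp0.le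
    have h6 : (∑ e ∈ S, f e ^ p.toReal) / (c ^ p.toReal / S.card) ≤ S.card := by
      rw [← h4]; exact h.trans (mul_le_of_le_one_left hk.le h5)
    rw [div_le_iff₀ (by positivity), mul_div_cancel₀ _ hk.ne'] at h6
    have hsum : ∑ e : S, ‖f e‖ ^ p.toReal = ∑ e ∈ S, f e ^ p.toReal := by
      rw [← Finset.sum_coe_sort S]
      exact Finset.sum_congr rfl fun e _ => by rw [Real.norm_of_nonneg (hf e)]
    have hnn : 0 ≤ ∑ e ∈ S, f e ^ p.toReal :=
      Finset.sum_nonneg fun e _ => Real.rpow_nonneg (hf e) _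
    rw [PiLp.norm_eq_sum hp0]
    simp only [hsum]
    rwa [one_div, Real.rpow_inv_le_iff_of_pos hnn hc.le hp0]
  · have hs0 : 0 < s := by linarith
    have he : Real.exp 1 < 2.7182818286 := Real.exp_one_lt_d9
    have hroot : (S.card : ℝ) ^ (1 / s) ≤ Real.exp 1 := by
      calc (S.card : ℝ) ^ (1 / s) ≤ Real.exp s ^ (1 / s) := by gcongr
        _ = Real.exp 1 := by rw [← Real.exp_mul, mul_one_div_cancel hs0.ne']
    have hroot' : (S.card : ℝ) ^ (1 / p.toReal) ≤ Real.exp 1 := by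
      rcases eq_or_ne p ⊤ with rfl | htop
      · simp
      · refine le_trans (Real.rpow_le_rpow_of_exponent_le hk1 ?_) hroot
        have : s ≤ p.toReal := by
          rw [← ENNReal.ofReal_le_iff_le_toReal htop]; exact (not_le.1 hps).le
        gcongr
    have hfe : ∀ e : S, ‖f e‖ ≤ Real.exp 1 / 8 * c := by
      intro e
      rw [Real.norm_of_nonneg (hf e), ← div_le_iff₀ hc]
      have h1 : (f e / c) ^ s ≤ (1 / 8) ^ s * S.card :=
        le_trans (Finset.single_le_sum (f := fun e => (f e / c) ^ s)
          (fun e _ => Real.rpow_nonneg (div_nonneg (hf e) hc.le) _) e.2) h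
      have h2 : f e / c ≤ ((1 / 8) ^ s * S.card) ^ (1 / s) := by
        rw [one_div s, Real.le_rpow_inv_iff_of_pos (div_nonneg (hf e) hc.le) (by positivity) hs0]
        exact h1
      refine h2.trans ?_
      rw [Real.mul_rpow (by positivity) hk.le, ← Real.rpow_mul (by norm_num),
        mul_one_div_cancel hs0.ne', Real.rpow_one]
      linarith
    have : Nonempty S := hS.to_subtype
    refine (PiLp.norm_le_card_rpow_mul hp hfe).trans ?_
    rw [Fintype.card_coe]
    calc (S.card : ℝ) ^ (1 / p.toReal) * (Real.exp 1 / 8 * c)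
        ≤ Real.exp 1 * (Real.exp 1 / 8 * c) := by gcongr
      _ = Real.exp 1 * Real.exp 1 / 8 * c := by ring
      _ ≤ 1 * c := by gcongr; nlinarith [Real.exp_pos 1]
      _ = c := one_mul c

/-- A bounded power mean of relative loads stays small after scaling down and adding a small
constant. -/
theorem sum_add_const_rpow_le {S : Finset E} {r : ℝ} (hr : 1 ≤ r) {f w : E → ℝ}
    (hf : ∀ e, 0 ≤ f e) (hw : ∀ e, 0 ≤ w e) (hfw : ∀ e, f e ≤ w e / 256 + 1 / 32)
    (h : ∑ e ∈ S, w e ^ r ≤ 8 ^ r * S.card) :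
    ∑ e ∈ S, f e ^ r ≤ (1 / 8) ^ r * S.card := by
  have hr0 : 0 ≤ r := by linarith
  have hpt : ∀ e, f e ^ r ≤ (1 / 128) ^ r * w e ^ r + (1 / 16) ^ r := by
    intro e
    have h0 := hw e
    rcases le_total (w e / 256) (1 / 32) with h1 | h1
    · have : f e ^ r ≤ (1 / 16) ^ r :=
        Real.rpow_le_rpow (hf e) ((hfw e).trans (by linarith)) hr0
      have : 0 ≤ (1 / 128 : ℝ) ^ r * w e ^ r := by positivity
      linarith
    · have h2 : f e ^ r ≤ (1 / 128 * w e) ^ r :=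
        Real.rpow_le_rpow (hf e) ((hfw e).trans (by linarith)) hr0
      rw [Real.mul_rpow (by norm_num) h0] at h2
      have : 0 ≤ (1 / 16 : ℝ) ^ r := by positivity
      linarith
  have h2 : (2 : ℝ) ≤ 2 ^ r := by
    calc (2 : ℝ) = 2 ^ (1 : ℝ) := by simp
      _ ≤ 2 ^ r := Real.rpow_le_rpow_of_exponent_le (by norm_num) hr
  calc ∑ e ∈ S, f e ^ r ≤ ∑ e ∈ S, ((1 / 128) ^ r * w e ^ r + (1 / 16) ^ r) :=
        Finset.sum_le_sum fun e _ => hpt e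
    _ = (1 / 128) ^ r * ∑ e ∈ S, w e ^ r + S.card * (1 / 16) ^ r := by
        rw [Finset.sum_add_distrib, ← Finset.mul_sum, Finset.sum_const, nsmul_eq_mul]
    _ ≤ (1 / 128) ^ r * (8 ^ r * S.card) + S.card * (1 / 16) ^ r := by gcongr
    _ = 2 * ((1 / 16) ^ r * S.card) := by
        rw [← mul_assoc, ← Real.mul_rpow (by norm_num) (by norm_num)]
        norm_num; ring
    _ ≤ 2 ^ r * ((1 / 16) ^ r * S.card) := by gcongr
    _ = (1 / 8) ^ r * S.card := by
        rw [← mul_assoc, ← Real.mul_rpow (by norm_num) (by norm_num)]; norm_num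

end Norms

/-! ### Algorithms that keep track of two load vectors -/

section Algorithm

variable {V E : Type*}

/-- A rule takes the loads of a virtual and of an actual routing and the newly arrived request, and
returns the virtual and the actual decision. -/
abbrev RoutingRule (V E : Type*) :=
  (E → ℕ) × (E → ℕ) → V × V → Option (List E) × Option (List E)

namespace RoutingRule

variable (D : RoutingRule V E)

/-- The virtual and the actual loads after the requests `past`. -/
noncomputable def loads (past : List (V × V)) : (E → ℕ) × (E → ℕ) :=
  past.foldl (fun σ r => (fun e => σ.1 e + decisionLoad (D σ r).1 e,
    fun e => σ.2 e + decisionLoad (D σ r).2 e)) (fun _ => 0, fun _ => 0)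

/-- The decisions on the `k`-th request of `reqs`; reject beyond the end of the sequence. -/
noncomputable def decisionAt (reqs : List (V × V)) (k : ℕ) :
    Option (List E) × Option (List E) :=
  match reqs[k]? with
  | none => (none, none)
  | some r => D (D.loads (reqs.take k)) r

theorem loads_take (reqs : List (V × V)) (k : ℕ) :
    D.loads (reqs.take k) = (prefixLoad (fun i => (D.decisionAt reqs i).1) k,
      prefixLoad (fun i => (D.decisionAt reqs i).2) k) := by
  induction k with
  | zero => rfl
  | succ k ih =>
    have hstep : D.loads (reqs.take (k + 1)) =
        (fun e => (D.loads (reqs.take k)).1 e + decisionLoad (D.decisionAt reqs k).1 e,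
          fun e => (D.loads (reqs.take k)).2 e + decisionLoad (D.decisionAt reqs k).2 e) := by
      rw [List.take_add_one]
      cases h : reqs[k]? with
      | none => simp [decisionAt, h]
      | some r => simp [decisionAt, h, loads, List.foldl_append]
    rw [hstep, ih]
    refine Prod.ext ?_ ?_ <;> funext e <;> simp only [prefixLoad_succ]

/-- The deterministic online algorithm that follows the actual decisions of a rule. -/
noncomputable def toAlgorithm : RandomizedOnlineAlgorithm V E where
  Ω := Unit
  mΩ := ⊤
  prob := Measure.dirac ()
  isProb := Measure.dirac.isProbabilityMeasure
  decide := fun _ past r => (D (D.loads past) r).2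
  measurableSet_decide := fun _ _ _ => trivial

theorem route_toAlgorithm (reqs : List (V × V)) (ω : D.toAlgorithm.Ω) (i : Fin reqs.length) :
    D.toAlgorithm.route reqs ω i = (D.decisionAt reqs i).2 := by
  simp [RandomizedOnlineAlgorithm.route, toAlgorithm, decisionAt]

end RoutingRule

/-- The extension of finitely many decisions by rejections. -/
def extendDecisions {n : ℕ} (R : Fin n → Option (List E)) (k : ℕ) : Option (List E) :=
  if h : k < n then R ⟨k, h⟩ else none

theorem load_eq_prefixLoad {n : ℕ} (R : Fin n → Option (List E)) (p : ℕ → Option (List E))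
    (h : ∀ i : Fin n, p i = R i) (e : E) : RoutingNetwork.load R e = prefixLoad p n e := by
  classical
  rw [RoutingNetwork.load, prefixLoad, ← Fin.sum_univ_eq_sum_range (fun k => decisionLoad (p k) e),
    Set.ncard_eq_toFinset_card', Finset.card_eq_sum_ones, Set.toFinset_ofPred, Finset.sum_filter]
  refine Finset.sum_congr rfl fun i _ => ?_
  rw [h i, decisionLoad]

theorem throughput_eq_prefixServed {n : ℕ} (R : Fin n → Option (List E))
    (p : ℕ → Option (List E)) (h : ∀ i : Fin n, p i = R i) :
    RoutingNetwork.throughput R = prefixServed p n := by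
  classical
  rw [RoutingNetwork.throughput, prefixServed,
    ← Fin.sum_univ_eq_sum_range (fun k => decisionServed (p k)),
    Set.ncard_eq_toFinset_card', Finset.card_eq_sum_ones, Set.toFinset_ofPred, Finset.sum_filter]
  refine Finset.sum_congr rfl fun i _ => ?_
  rw [h i, decisionServed]
  cases R i <;> simp

variable {J : Type*} [Fintype E] [Fintype J]

open Classical in
/-- The virtual decision serves the request along any admissible path of total price at most `1`, if
there is one. -/
noncomputable def AgentFamily.virtualDecision (F : AgentFamily E J)
    (admissible : V × V → List E → Prop) (n : E → ℕ) (r : V × V) : Option (List E) :=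
  if h : ∃ P, admissible r P ∧
      ∑ e, F.edgePrice (F.shiftedLoad n) e * decisionLoad (some P) e ≤ 1
  then some h.choose else none

open Classical in
/-- The rule that routes virtually along cheap paths, and actually serves a virtually served request
if its path has small total overload. -/
noncomputable def AgentFamily.rule (F : AgentFamily E J)
    (admissible : V × V → List E → Prop) : RoutingRule V E := fun σ r =>
  (F.virtualDecision admissible σ.1 r,
    if ∑ e, overload F.q σ.1 σ.2 e * decisionLoad (F.virtualDecision admissible σ.1 r) e ≤ 1
    then F.virtualDecision admissible σ.1 r else none)

namespace AgentFamily

variable (F : AgentFamily E J) (admissible : V × V → List E → Prop)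

theorem sum_edgePrice_virtualDecision_le (n : E → ℕ) (r : V × V) :
    ∑ e, F.edgePrice (F.shiftedLoad n) e * decisionLoad (F.virtualDecision admissible n r) e
      ≤ 1 := by
  unfold virtualDecision
  split_ifs with h
  · exact h.choose_spec.2
  · simp

theorem admissible_of_virtualDecision_eq {n : E → ℕ} {r : V × V} {P : List E}
    (hP : F.virtualDecision admissible n r = some P) : admissible r P := by
  unfold virtualDecision at hP
  split_ifs at hP with h
  rw [← Option.some.inj hP]
  exact h.choose_spec.1

theorem one_lt_of_virtualDecision_eq_none {n : E → ℕ} {r : V × V} {P : List E}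
    (h : F.virtualDecision admissible n r = none) (hP : admissible r P) :
    1 < ∑ e, F.edgePrice (F.shiftedLoad n) e * decisionLoad (some P) e := by
  by_contra hcon
  rw [virtualDecision, dif_pos ⟨P, hP, not_lt.1 hcon⟩] at h
  simp at h

variable (reqs : List (V × V))

/-- The virtual decisions on a sequence of requests. -/
noncomputable def virtualRun (k : ℕ) : Option (List E) :=
  ((F.rule admissible).decisionAt reqs k).1

/-- The actual decisions on a sequence of requests. -/
noncomputable def actualRun (k : ℕ) : Option (List E) :=
  ((F.rule admissible).decisionAt reqs k).2

theorem virtualRun_eq (k : ℕ) : F.virtualRun admissible reqs k = reqs[k]?.bind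
    (F.virtualDecision admissible (prefixLoad (F.virtualRun admissible reqs) k)) := by
  have h := (F.rule admissible).loads_take reqs k
  unfold virtualRun RoutingRule.decisionAt
  cases hr : reqs[k]? with
  | none => rfl
  | some r =>
    simp only [h, Option.bind_some]
    rfl

theorem isThinning_run :
    IsThinning F.q (F.virtualRun admissible reqs) (F.actualRun admissible reqs) := by
  intro k
  have h := (F.rule admissible).loads_take reqs k
  have hv := F.virtualRun_eq admissible reqs k
  have ha : F.actualRun admissible reqs k = ((F.rule admissible).decisionAt reqs k).2 := rfl
  rw [RoutingRule.decisionAt] at ha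
  cases hr : reqs[k]? with
  | none =>
    rw [hr] at hv ha
    left
    simp only [Option.bind_none] at hv ha
    rw [hv, ha]
    simp
  | some r =>
    rw [hr] at hv ha
    simp only [Option.bind_some, h] at hv ha
    change _ = F.virtualDecision admissible (prefixLoad (F.virtualRun admissible reqs) k) r at hv
    change F.actualRun admissible reqs k = ite (∑ e, overload F.q
      (prefixLoad (F.virtualRun admissible reqs) k) (prefixLoad (F.actualRun admissible reqs) k) e *
      (decisionLoad (F.virtualDecision admissible
        (prefixLoad (F.virtualRun admissible reqs) k) r) e : ℝ) ≤ 1)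
      (F.virtualDecision admissible (prefixLoad (F.virtualRun admissible reqs) k) r) none at ha
    rw [← hv] at ha
    split_ifs at ha with hc
    · exact Or.inl ⟨hc, ha⟩
    · exact Or.inr ⟨not_le.1 hc, ha⟩

end AgentFamily

end Algorithm

/-! ### The competitive algorithm -/

section Main

variable {V E J : Type*} [Fintype E]

theorem card_nonempty_agents_le [Finite J] (N : RoutingNetwork V E J) {L : ℕ}
    [Fintype {j // (N.S j).Nonempty}] (h : ∀ e : E, {j : J | e ∈ N.S j}.ncard ≤ L) :
    Fintype.card {j // (N.S j).Nonempty} ≤ L * Fintype.card E := by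
  classical
  have := Fintype.ofFinite J
  calc Fintype.card {j // (N.S j).Nonempty}
      = ∑ _j : {j // (N.S j).Nonempty}, 1 := by simp
    _ ≤ ∑ j : {j // (N.S j).Nonempty}, (N.S j).card :=
        Finset.sum_le_sum fun j _ => j.2.card_pos
    _ = ∑ j ∈ Finset.univ.filter (fun j => (N.S j).Nonempty), (N.S j).card := by
        rw [← Finset.sum_subtype_eq_sum_filter]
        exact Finset.sum_congr (by ext; simp) fun _ _ => rfl
    _ ≤ ∑ j : J, (N.S j).card := Finset.sum_le_sum_of_subset (Finset.filter_subset _ _)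
    _ = ∑ j : J, ∑ e : E, if e ∈ N.S j then 1 else 0 := by simp
    _ = ∑ e : E, {j : J | e ∈ N.S j}.ncard := by
        rw [Finset.sum_comm]
        refine Finset.sum_congr rfl fun e _ => ?_
        rw [Set.ncard_eq_toFinset_card', Set.toFinset_ofPred, Finset.card_filter]
    _ ≤ ∑ _e : E, L := Finset.sum_le_sum fun e _ => h e
    _ = L * Fintype.card E := by simp [mul_comm]

/-- The agents with nonempty sets in a network with large capacities form an `AgentFamily` of
degree `q = 5 * log (L * m)`, with `d j` equal to `q / 512` times the capacity per edge. -/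
theorem exists_agentFamily [Finite J] (N : RoutingNetwork V E J) {L : ℕ}
    [Fintype {j // (N.S j).Nonempty}]
    (hE : 2 ≤ Fintype.card E) (hL : 1 ≤ L)
    (hLe : ∀ e : E, {j : J | e ∈ N.S j}.ncard ≤ L)
    (hcap : ∀ j : {j // (N.S j).Nonempty}, 4096 * Real.log (Fintype.card E) ≤
      edgeCapacity (2 * Real.log (Fintype.card E)) (N.p j) (N.c j) (N.S j).card) :
    ∃ F : AgentFamily E {j // (N.S j).Nonempty},
      F.q = 5 * Real.log (L * Fintype.card E) ∧ (∀ j, F.S j = N.S j) ∧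
      (∀ j, F.r j = truncExponent (2 * Real.log (Fintype.card E)) (N.p j)) ∧
      ∀ j, 512 * F.d j / F.q =
        edgeCapacity (2 * Real.log (Fintype.card E)) (N.p j) (N.c j) (N.S j).card := by
  have hm : (2 : ℝ) ≤ Fintype.card E := by exact_mod_cast hE
  have hL' : (1 : ℝ) ≤ L := by exact_mod_cast hL
  have hlog2 : 0.6931471803 < Real.log 2 := Real.log_two_gt_d9
  have hℓ : Real.log 2 ≤ Real.log (Fintype.card E) := Real.log_le_log (by norm_num) hm
  have hmM : (Fintype.card E : ℝ) ≤ L * Fintype.card E :=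
    le_mul_of_one_le_left (by linarith) hL'
  have hlam : Real.log (Fintype.card E) ≤ Real.log (L * Fintype.card E) :=
    Real.log_le_log (by linarith) hmM
  set ℓ := Real.log (Fintype.card E) with hℓdef
  set lam := Real.log (L * Fintype.card E) with hlamdef
  set g : {j // (N.S j).Nonempty} → ℝ := fun j =>
    edgeCapacity (2 * ℓ) (N.p j) (N.c j) (N.S j).card with hg
  have hgpos : ∀ j, 0 < g j := fun j => by have := hcap j; simp only [hg]; linarith
  have hlam0 : 0 < lam := by linarith
  refine ⟨{ S := fun j => N.S j
            r := fun j => truncExponent (2 * ℓ) (N.p j)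
            d := fun j => 5 * lam * g j / 512
            q := 5 * lam
            M := L * Fintype.card E
            nonempty := fun j => j.2
            one_le_r := fun j => one_le_truncExponent (by linarith) (N.one_le_p j)
            r_add_one_le := fun j => by
              have := truncExponent_le (p := N.p j) (s := 2 * ℓ) (by linarith)
              linarith
            two_le_q := by linarith
            d_pos := fun j => by have := hgpos j; positivity
            q_le_d := fun j => ?_
            card_agents_le := by exact_mod_cast card_nonempty_agents_le N hLe
            card_edges_le := hmM
            sq_mul_exp_le := ?_ }, rfl, fun j => rfl, fun j => rfl, fun j => ?_⟩
  · have h1 := hgpos j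
    have h2 : 5 * lam / (5 * lam * g j / 512) = 512 / g j := by field_simp
    rw [h2, Real.exp_neg, div_le_iff₀ h1, inv_mul_eq_div, le_div_iff₀ (Real.exp_pos 1)]
    have h3 : Real.exp 1 < 2.7182818286 := Real.exp_one_lt_d9
    have h4 := hcap j
    simp only [hg]
    linarith
  · have h1 : ((L : ℝ) * Fintype.card E) = Real.exp lam := by
      rw [hlamdef, Real.exp_log (by positivity)]
    rw [h1, ← Real.exp_nat_mul, ← Real.exp_add, Real.exp_le_one_iff]
    push_cast
    linarith
  · simp only
    field_simp
    rfl

/-- The loads of the thinned routing are at most those of the virtual one, scaled down to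
bandwidth `1 / q` per request, plus `log m + 1`; the large capacities leave room for both. -/
theorem AgentFamily.sum_actual_load_rpow_le [Nonempty E] {J' : Type*} [Fintype J']
    (F : AgentFamily E J') {p a : ℕ → Option (List E)}
    (hp : ∀ k, ∑ e, F.edgePrice (F.shiftedLoad (prefixLoad p k)) e * decisionLoad (p k) e ≤ 1)
    (ha : IsThinning F.q p a) (n : ℕ) (j : J')
    (hcap : 32 * (Real.log (Fintype.card E) + 1) ≤ 512 * F.d j / F.q) :
    ∑ e ∈ F.S j, ((prefixLoad a n e : ℝ) / (512 * F.d j / F.q)) ^ F.r j ≤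
      (1 / 8) ^ F.r j * (F.S j).card := by
  have hq := AgentFamily.q_pos (F := F)
  have hd := F.d_pos j
  refine sum_add_const_rpow_le (F.one_le_r j) (fun e => by positivity) (fun e => ?_)
    (fun e => ?_) (AgentFamily.sum_shiftedLoad_rpow_le hp n j)
  · have := AgentFamily.shiftedLoad_pos (F := F) (prefixLoad p n) e
    positivity
  · have h1 := ha.prefixLoad_le F.two_le_q n e
    have hg : 0 < 512 * F.d j / F.q := by positivity
    have h2 : (prefixLoad p n e : ℝ) ≤ F.shiftedLoad (prefixLoad p n) e := by
      simp only [AgentFamily.shiftedLoad]; linarith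
    rw [div_le_iff₀ hg]
    have h3 : (F.shiftedLoad (prefixLoad p n) e / F.d j / 256 + 1 / 32) * (512 * F.d j / F.q) =
        2 / F.q * F.shiftedLoad (prefixLoad p n) e + (512 * F.d j / F.q) / 32 := by
      field_simp; ring
    rw [h3]
    have h4 : 2 / F.q * (prefixLoad p n e : ℝ) ≤
        2 / F.q * F.shiftedLoad (prefixLoad p n) e := by gcongr
    linarith

end Main

theorem mainTheorem4 :
    ∃ A C : ℝ, 0 < A ∧ 0 < C ∧
      ∀ (V E J : Type*) [Finite V] [Fintype E] [Finite J] (N : RoutingNetwork V E J) (L : ℕ),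
        2 ≤ Fintype.card E →
        1 ≤ L →
        (∀ e : E, {j : J | e ∈ N.S j}.ncard ≤ L) →
        (∀ j : J, A * Real.log (Fintype.card E) *
          ((N.S j).card : ℝ) ^ (1 / (N.p j).toReal) ≤ N.c j) →
        ∃ alg : RandomizedOnlineAlgorithm V E,
          N.IsCompetitive alg (C * Real.log (L * Fintype.card E)) := by
  -- `266260 = (1 + 26 * 512) * 4 * 5`: constant-competitive virtual routing with `b = 512`,
  -- thinning by `4 * q`, and `q = 5 * log (L * m)`
  refine ⟨4096, 266260, by norm_num, by norm_num, ?_⟩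
  intro V E J _ _ _ N L hE hL hLe hc
  have hm : (2 : ℝ) ≤ Fintype.card E := by exact_mod_cast hE
  have hlog2 : 0.6931471803 < Real.log 2 := Real.log_two_gt_d9
  have hℓ : Real.log 2 ≤ Real.log (Fintype.card E) := Real.log_le_log (by norm_num) hm
  have : Nonempty E := Fintype.card_pos_iff.1 (by omega)
  set ℓ := Real.log (Fintype.card E) with hℓdef
  have hs : 1 ≤ 2 * ℓ := by linarith
  have hcap : ∀ j : {j // (N.S j).Nonempty}, 4096 * ℓ ≤
      edgeCapacity (2 * ℓ) (N.p j) (N.c j) (N.S j).card := fun j =>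
    le_edgeCapacity j.2.card_pos (by linarith) (hc j)
  have hcpos : ∀ j, (N.S j).Nonempty → 0 < N.c j := fun j hj => by
    refine lt_of_lt_of_le ?_ (hc j)
    have : (0 : ℝ) < (N.S j).card := by exact_mod_cast hj.card_pos
    have : 0 < ℓ := by linarith
    positivity
  have := Fintype.ofFinite {j // (N.S j).Nonempty}
  obtain ⟨F, hFq, hFS, hFr, hFd⟩ := exists_agentFamily N hE hL hLe hcap
  set adm : V × V → List E → Prop := fun r P => N.IsSimplePath r.1 r.2 P with hadm
  refine ⟨(F.rule adm).toAlgorithm, fun reqs => ?_⟩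
  set p := F.virtualRun adm reqs with hpdef
  set a := F.actualRun adm reqs with hadef
  have hthin : IsThinning F.q p a := F.isThinning_run adm reqs
  have hpk : ∀ k, p k = reqs[k]?.bind (F.virtualDecision adm (prefixLoad p k)) :=
    F.virtualRun_eq adm reqs
  have hcheap : ∀ k, ∑ e, F.edgePrice (F.shiftedLoad (prefixLoad p k)) e *
      decisionLoad (p k) e ≤ 1 := by
    intro k
    rw [hpk k]
    cases reqs[k]? with
    | none => simp
    | some r => exact F.sum_edgePrice_virtualDecision_le adm _ r
  have hroute : ∀ (ω : (F.rule adm).toAlgorithm.Ω) (i : Fin reqs.length),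
      a i = (F.rule adm).toAlgorithm.route reqs ω i := fun ω i =>
    ((F.rule adm).route_toAlgorithm reqs ω i).symm
  refine ⟨fun ω => ⟨fun i P hP => ?_, fun j => ?_⟩, fun R hR => ?_⟩
  · rw [← hroute ω i] at hP
    have hpP : p i = some P := by
      rcases hthin i with ⟨_, h⟩ | ⟨_, h⟩
      · rw [← h]; exact hP
      · rw [h] at hP; simp at hP
    rw [hpk, List.getElem?_eq_getElem i.2] at hpP
    exact F.admissible_of_virtualDecision_eq adm hpP
  · simp only [load_eq_prefixLoad _ a (hroute ω)]
    rcases (N.S j).eq_empty_or_nonempty with hj | hj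
    · have hfact : Fact (1 ≤ N.p j) := ⟨N.one_le_p j⟩
      -- here the capacity may be `0`, but the norm is that of an empty vector
      have hempty : IsEmpty (N.S j) := by rw [hj]; infer_instance
      rw [Subsingleton.elim (WithLp.toLp (N.p j)
        fun e : N.S j => (prefixLoad a reqs.length (e : E) : ℝ)) 0, norm_zero]
      refine le_trans ?_ (hc j)
      have : 0 ≤ ℓ := by linarith
      positivity
    · refine norm_le_of_sum_div_edgeCapacity_rpow_le (s := 2 * ℓ) hj hs (N.one_le_p j)
        (hcpos j hj) ?_ (f := fun e => (prefixLoad a reqs.length e : ℝ))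
        (fun e => Nat.cast_nonneg _) ?_
      · calc ((N.S j).card : ℝ) ≤ Fintype.card E := by exact_mod_cast Finset.card_le_univ _
          _ = Real.exp ℓ := by rw [hℓdef, Real.exp_log (by linarith)]
          _ ≤ Real.exp (2 * ℓ) := by gcongr; linarith
      · have h1 := F.sum_actual_load_rpow_le hcheap hthin reqs.length ⟨j, hj⟩ (by
          rw [hFd]; have := hcap ⟨j, hj⟩; linarith)
        rw [hFd, hFr, hFS] at h1
        exact h1
  · have hRext : ∀ i : Fin reqs.length, extendDecisions R i = R i := fun i => by
      simp [extendDecisions]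
    have hopt := AgentFamily.prefixServed_le_of_cheap (F := F) hcheap
      (R := extendDecisions R) (n := reqs.length) (fun k hk hRk hpn => by
        obtain ⟨P, hP⟩ := Option.ne_none_iff_exists'.1 hRk
        have hP' : R ⟨k, hk⟩ = some P := by rw [← hRext]; exact hP
        rw [hpk, List.getElem?_eq_getElem hk] at hpn
        rw [hP]
        exact F.one_lt_of_virtualDecision_eq_none adm hpn (hR.1 ⟨k, hk⟩ P hP'))
      (b := 512) (by norm_num) (fun j => by
        rw [hFd, hFr, hFS]
        refine sum_div_edgeCapacity_rpow_le j.2 hs (N.one_le_p j) (hcpos j j.2)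
          (f := fun e => (prefixLoad (extendDecisions R) reqs.length e : ℝ))
          (fun e => Nat.cast_nonneg _) ?_
        simp only [← load_eq_prefixLoad R _ hRext]
        exact hR.2 j)
    have hkeep := hthin.prefixServed_le F.two_le_q reqs.length
    have hint : ∫ ω, (RoutingNetwork.throughput ((F.rule adm).toAlgorithm.route reqs ω) : ℝ)
        ∂(F.rule adm).toAlgorithm.prob = prefixServed a reqs.length := by
      simp only [throughput_eq_prefixServed _ a (hroute _)]
      simp
    rw [hint, throughput_eq_prefixServed R _ hRext]
    calc (prefixServed (extendDecisions R) reqs.length : ℝ)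
        ≤ (1 + 26 * 512) * prefixServed p reqs.length := hopt
      _ ≤ (1 + 26 * 512) * (4 * F.q * prefixServed a reqs.length) := by gcongr
      _ = _ := by rw [hFq]; ring
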